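/- **Setting.** Let $\mathsf Z$ be a Polish space with its Borel $\sigma$-field, $d\ge 1$, and let $\mathrm Q$ be a Markov kernel on $\mathsf Z$ with invariant probability $\pi$. Assume that for some integer $t_{\rm mix}\ge 1$ the Dobrushin coefficients $\mathsf\Delta(\mathrm Q^k)=\sup_{z,z'}\tfrac12\|\mathrm Q^k(z,\cdot)-\mathrm Q^k(z',\cdot)\|_{\rm TV}$ satisfy $\mathsf\Delta(\mathrm Q^k)\le (1/4)^{\lfloor k/t_{\rm mix}\rfloor}$ for all $k\ge1$. Let $\mathbf A:\mathsf Z\to\mathbb R^{d\times d}$ and $\mathbf b:\mathsf Z\to\mathbb R^d$ be measurable, with $\bar{\mathbf A}=\int \mathbf A\,d\pi$, $\bar{\mathbf b}=\int\mathbf b\,d\pi$, $\tilde{\mathbf A}(z)=\mathbf A(z)-\bar{\mathbf A}$, and assume that $-\bar{\mathbf A}$ is Hurwitz and $C_A=\sup_z\|\mathbf A(z)\|\vee\sup_z\|\tilde{\mathbf A}(z)\|<\infty$. Let $\theta^\star$ solve $\bar{\mathbf A}\theta^\star=\bar{\mathbf b}$, put $\varepsilon(z)=\tilde{\mathbf A}(z)\theta^\star-(\mathbf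 b(z)-\bar{\mathbf b})$, and assume $\|\varepsilon\|_\infty=\sup_z\|\varepsilon(z)\|<\infty$. Let $S$ be the unique symmetric positive definite solution of $\bar{\mathbf A}^\top S+S\bar{\mathbf A}=\mathrm I$, and let $\|x\|_S=(x^\top Sx)^{1/2}$, $\|B\|_S$ the corresponding operator norm, $\kappa=\lambda_{\max}(S)/\lambda_{\min}(S)$, $a=\tfrac12\|S\|^{-1}$, $m=\lceil 8\kappa^{1/2}C_A/a\rceil$, $$\alpha_\infty=\tfrac12\|\bar{\mathbf A}\|_S^{-2}\|S\|^{-1}\wedge\|S\|,\qquad \alpha^{(M)}_\infty=\Big[\alpha_\infty\wedge\kappa^{-1/2}C_A^{-1}\wedge\frac{a}{6e\,\kappa\, C_A}\Big]m^{-1},\qquad C_\Gamma=4\big(\kappa^{1/2}C_A+a/6\big)^2m,$$ $$\alpha^{(M)}_{q,\infty}=\alpha^{(M)}_\infty\wedge\frac{a}{12\,C_\Gamma\, q},\qquad \alpha^{(b)}_{1,\infty}=\Big(\alpha^{(M)}_{1+\log d,\infty}\wedge\frac1{1+C_A}\wedge\frac1a\Big)t_{\rm mix}^{-1},$$ $$D_1=2^{7/2}\kappa^{1/2}a^{-1}\big(e^{-1/4}+\sqrt{2\pi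 e}\,C_Aa^{-1}\big)\ \text{ (here $\pi=3.14\ldots$)},\qquad D_b=C_A^3\big(12\,D_1C_A\,a^{1/2}+24(e^{2/t_{\rm mix}}-1)\big).$$ Let $(Z_n)_{n\ge0}$ be a Markov chain with kernel $\mathrm Q$ and arbitrary initial law. For $\alpha>0$ let $J^{(l,\alpha)}_0=0$ and, for $n\ge1$, $$J^{(0,\alpha)}_n=(\mathrm I-\alpha\bar{\mathbf A})J^{(0,\alpha)}_{n-1}-\alpha\,\varepsilon(Z_n),\qquad J^{(l,\alpha)}_n=(\mathrm I-\alpha\bar{\mathbf A})J^{(l,\alpha)}_{n-1}-\alpha\,\tilde{\mathbf A}(Z_n)J^{(l-1,\alpha)}_{n-1}\quad(l=1,2).$$ Write $(Z_{\infty+n})_{n\ge0}$ for the stationary chain, i.e. the chain with kernel $\mathrm Q$ and $Z_\infty\sim\pi$. **Proposition.** Let $\alpha\in(0,\alpha^{(b)}_{1,\infty})$. Then the Markov kernel of the chain $(Z_{n+1},J_n^{(0,\alpha)},J_n^{(1,\alpha)},J_n^{(2,\alpha)})$ on $\mathsf Z\times(\mathbb R^d)^3$ has a unique invariant probability distribution;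 let $J_\infty^{(2,\alpha)}$ be the last component of a random vector with this distribution. The vectors $J_n^{(2,\alpha)}$, $n\ge0$, and $J_\infty^{(2,\alpha)}$ are integrable, and $$\lim_{n\to\infty}\mathbb E[J_n^{(2,\alpha)}]=\mathbb E[J_\infty^{(2,\alpha)}]=\alpha^2\Delta_2+R_2(\alpha),$$ where $$\Delta_2=-\bar{\mathbf A}^{-1}\sum_{k=1}^\infty\sum_{i=0}^\infty\mathbb E\big[\tilde{\mathbf A}(Z_{\infty+k+i+1})\,\tilde{\mathbf A}(Z_{\infty+i+1})\,\varepsilon(Z_\infty)\big],$$ the double series converging absolutely, and $$\|\bar{\mathbf A}R_2(\alpha)\|\le D_b\,t_{\rm mix}^4\,\alpha^{5/2}\,\|\varepsilon\|_\infty,\qquad\text{hence}\qquad \|R_2(\alpha)\|\le\|\bar{\mathbf A}^{-1}\|\,D_b\,t_{\rm mix}^4\,\alpha^{5/2}\,\|\varepsilon\|_\infty .$$ -/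

import Mathlib

open MeasureTheory ProbabilityTheory Filter Topology

noncomputable section

namespace LSA

/-! ## Vectors, matrices, constants -/

/-- `ℝ^d` with the Euclidean norm. -/
abbrev Vec (d : ℕ) : Type := EuclideanSpace ℝ (Fin d)

/-- Real `d × d` matrices, as linear maps of Euclidean space, with the spectral norm. -/
abbrev Mat (d : ℕ) : Type := Vec d →L[ℝ] Vec d

/-- A matrix is Hurwitz if all its complex eigenvalues (roots of its characteristic polynomial)
have negative real part. -/
def IsHurwitz {d : ℕ} (B : Mat d) : Prop :=
  ∀ μ : ℂ, ((LinearMap.charpoly (B : Vec d →ₗ[ℝ] Vec d)).map (algebraMap ℝ ℂ)).IsRoot μ → μ.re < 0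

/-- `S` is the symmetric positive definite solution of the Lyapunov equation
`Abarᵀ S + S Abar = I`. -/
structure IsLyapunovSolution {d : ℕ} (Abar S : Mat d) : Prop where
  symm : IsSelfAdjoint S
  pos : ∀ x : Vec d, x ≠ 0 → 0 < inner ℝ (S x) x
  eqn : ContinuousLinearMap.adjoint Abar * S + S * Abar = 1

/-- The norm `‖x‖_S = (xᵀ S x)^{1/2}`. -/
def wNorm {d : ℕ} (S : Mat d) (x : Vec d) : ℝ := √(inner ℝ (S x) x)

/-- The operator norm `‖B‖_S = max {‖B x‖_S : ‖x‖_S = 1}`. -/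
def wOpNorm {d : ℕ} (S B : Mat d) : ℝ := sSup {r : ℝ | ∃ x : Vec d, wNorm S x = 1 ∧ r = wNorm S (B x)}

/-- Largest (real) eigenvalue. -/
def lamMax {d : ℕ} (S : Mat d) : ℝ :=
  sSup {μ : ℝ | Module.End.HasEigenvalue (S : Vec d →ₗ[ℝ] Vec d) μ}

/-- Smallest (real) eigenvalue. -/
def lamMin {d : ℕ} (S : Mat d) : ℝ :=
  sInf {μ : ℝ | Module.End.HasEigenvalue (S : Vec d →ₗ[ℝ] Vec d) μ}

/-- `κ = λ_max(S) / λ_min(S)`. -/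
def kappa {d : ℕ} (S : Mat d) : ℝ := lamMax S / lamMin S

/-- `a = ‖S‖⁻¹ / 2`. -/
def rateA {d : ℕ} (S : Mat d) : ℝ := ‖S‖⁻¹ / 2

/-- `α_∞ = ((1/2) ‖Abar‖_S⁻² ‖S‖⁻¹) ∧ ‖S‖`. -/
def alphaInf {d : ℕ} (Abar S : Mat d) : ℝ :=
  min ((1 / 2) * (wOpNorm S Abar ^ 2)⁻¹ * ‖S‖⁻¹) ‖S‖

/-- The integer `⌈8 κ^{1/2} C_A / a⌉`. -/
def blockLen {d : ℕ} (S : Mat d) (CA : ℝ) : ℕ := ⌈8 * √(kappa S) * CA / rateA S⌉₊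

/-- `α_∞^{(M)}`. -/
def alphaInfM {d : ℕ} (Abar S : Mat d) (CA : ℝ) : ℝ :=
  min (alphaInf Abar S)
    (min ((√(kappa S))⁻¹ * CA⁻¹) (rateA S / (6 * Real.exp 1 * kappa S * CA)))
    * (blockLen S CA : ℝ)⁻¹

/-- `C_Γ`. -/
def constGamma {d : ℕ} (S : Mat d) (CA : ℝ) : ℝ :=
  4 * (√(kappa S) * CA + rateA S / 6) ^ 2 * (blockLen S CA : ℝ)

/-- `α_{q,∞}^{(M)} = α_∞^{(M)} ∧ (a / (12 C_Γ)) / q`. -/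
def alphaM {d : ℕ} (Abar S : Mat d) (CA q : ℝ) : ℝ :=
  min (alphaInfM Abar S CA) (rateA S / (12 * constGamma S CA) / q)

/-- `α_{p,∞}^{(b)} = (α_{p(1+log d),∞}^{(M)} ∧ 1/(1+C_A) ∧ 1/(a p)) / t_mix`. -/
def alphaB {d : ℕ} (Abar S : Mat d) (CA : ℝ) (tmix : ℕ) (p : ℝ) : ℝ :=
  min (alphaM Abar S CA (p * (1 + Real.log d)))
    (min (1 / (1 + CA)) (1 / (rateA S * p))) * (tmix : ℝ)⁻¹

/-- `D_1 = 2^{7/2} κ^{1/2} a⁻¹ (e^{-1/4} + √(2πe) C_A a⁻¹)`. -/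
def constD1 {d : ℕ} (S : Mat d) (CA : ℝ) : ℝ :=
  (2 : ℝ) ^ (7 / 2 : ℝ) * √(kappa S) * (rateA S)⁻¹ *
    (Real.exp (-1 / 4) + √(2 * Real.pi * Real.exp 1) * CA * (rateA S)⁻¹)

/-- `D_b = C_A³ (12 D_1 C_A a^{1/2} + 24 (e^{2/t_mix} - 1))`. -/
def constDb {d : ℕ} (S : Mat d) (CA : ℝ) (tmix : ℕ) : ℝ :=
  CA ^ 3 * (12 * constD1 S CA * CA * √(rateA S) + 24 * (Real.exp (2 / (tmix : ℝ)) - 1))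

/-! ## Markov chains -/

section Chains

variable {Z : Type*} [MeasurableSpace Z]

/-- Total variation norm `|μ - ν|(Z)` of the difference of two finite measures. -/
def tvNorm (μ ν : Measure Z) [IsFiniteMeasure μ] [IsFiniteMeasure ν] : ℝ :=
  ((μ.toSignedMeasure - ν.toSignedMeasure).totalVariation Set.univ).toReal

/-- Dobrushin coefficient `sup_{z,z'} (1/2) ‖K(z,·) - K(z',·)‖_TV` of a Markov kernel. -/
def dobrushin (K : Kernel Z Z) [IsMarkovKernel K] : ℝ :=
  ⨆ p : Z × Z, (1 / 2 : ℝ) * tvNorm (K p.1) (K p.2)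

instance isMarkovKernel_pow (Q : Kernel Z Z) [IsMarkovKernel Q] (k : ℕ) :
    IsMarkovKernel (Q ^ k) := by
  induction k with
  | zero => rw [pow_zero]; exact inferInstanceAs (IsMarkovKernel (Kernel.id : Kernel Z Z))
  | succ k ih => rw [pow_succ]; exact inferInstanceAs (IsMarkovKernel ((Q ^ k) ∘ₖ Q))

/-- `(X_n)` is a Markov chain with kernel `Q` (and arbitrary initial law) under `P`: given
`X_0, …, X_n`, the law of `X_{n+1}` is `Q(X_n, ·)`. -/
structure IsMarkovChain {Ω : Type*} [MeasurableSpace Ω] (Q : Kernel Z Z) (P : Measure Ω)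
    (X : ℕ → Ω → Z) : Prop where
  measurable : ∀ n, Measurable (X n)
  transition : ∀ n : ℕ,
    P.map (fun ω => ((fun i : Fin (n + 1) => X i ω), X (n + 1) ω)) =
      (P.map (fun ω => fun i : Fin (n + 1) => X i ω)) ⊗ₘ
        (Q.comap (fun h : Fin (n + 1) → Z => h (Fin.last n)) (measurable_pi_apply _))

end Chains

/-! ## The linear stochastic approximation expansion -/

section Expansion

variable {Z : Type*} [MeasurableSpace Z] {d : ℕ}

/-- `Ã(z) = A(z) - Abar`. -/
def centered (A : Z → Mat d) (Abar : Mat d) (z : Z) : Mat d := A z - Abar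

/-- `ε(z) = Ã(z) θ⋆ - (b(z) - bbar)`. -/
def noise (A : Z → Mat d) (b : Z → Vec d) (Abar : Mat d) (bbar θ : Vec d) (z : Z) : Vec d :=
  centered A Abar z θ - (b z - bbar)

/-- `C_A = sup ‖A(z)‖ ∨ sup ‖Ã(z)‖`. -/
def constA (A : Z → Mat d) (Abar : Mat d) : ℝ :=
  max (⨆ z, ‖A z‖) (⨆ z, ‖centered A Abar z‖)

/-- `‖g‖_∞ = sup_z ‖g(z)‖`. -/
def supNorm (g : Z → Vec d) : ℝ := ⨆ z, ‖g z‖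

/-- The terms `J_n^{(l,α)}` along a path `x`, where `At` stands for `Ã` and `e` for `ε`:
`J_n^{(0)} = (I - α Abar) J_{n-1}^{(0)} - α ε(x_n)`,
`J_n^{(l)} = (I - α Abar) J_{n-1}^{(l)} - α Ã(x_n) J_{n-1}^{(l-1)}`, `J_0^{(l)} = 0`. -/
def J (α : ℝ) (Abar : Mat d) (At : Z → Mat d) (e : Z → Vec d) (x : ℕ → Z) : ℕ → ℕ → Vec d
  | _, 0 => 0
  | 0, n + 1 => (1 - α • Abar) (J α Abar At e x 0 n) - α • e (x (n + 1))
  | l + 1, n + 1 =>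
      (1 - α • Abar) (J α Abar At e x (l + 1) n) - α • At (x (n + 1)) (J α Abar At e x l n)

/-- One step `(z, j₀, j₁, j₂) ↦ (j₀', j₁', j₂')` of the recursions for `J^{(0)}, J^{(1)}, J^{(2)}`,
driven by `z`. -/
def stepJ (α : ℝ) (Abar : Mat d) (At : Z → Mat d) (e : Z → Vec d)
    (y : Z × Vec d × Vec d × Vec d) : Vec d × Vec d × Vec d :=
  ((1 - α • Abar) y.2.1 - α • e y.1,
    (1 - α • Abar) y.2.2.1 - α • At y.1 y.2.1,
    (1 - α • Abar) y.2.2.2 - α • At y.1 y.2.2.1)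

theorem measurable_stepJ (α : ℝ) (Abar : Mat d) {At : Z → Mat d} {e : Z → Vec d}
    (hAt : Measurable At) (he : Measurable e) : Measurable (stepJ α Abar At e) := by
  unfold stepJ
  have h1 : ∀ f : Z × Vec d × Vec d × Vec d → Vec d, Measurable f →
      Measurable (fun y => At y.1 (f y)) := by
    intro f hf
    have hc : Continuous (fun q : Mat d × Vec d => q.1 q.2) := by fun_prop
    exact hc.measurable.comp ((hAt.comp measurable_fst).prodMk hf)
  have h2 := h1 (fun y => y.2.1) (by fun_prop)
  have h3 := h1 (fun y => y.2.2.1) (by fun_prop)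
  have h4 : ∀ f : Z × Vec d × Vec d × Vec d → Vec d, Measurable f →
      Measurable (fun y => (1 - α • Abar) (f y)) :=
    fun f hf => (1 - α • Abar).continuous.measurable.comp hf
  have h5 : Measurable (fun y : Z × Vec d × Vec d × Vec d => e y.1) := he.comp measurable_fst
  exact ((h4 _ (by fun_prop)).sub (h5.const_smul α)).prodMk
    (((h4 _ (by fun_prop)).sub (h2.const_smul α)).prodMk
      ((h4 _ (by fun_prop)).sub (h3.const_smul α)))

theorem measurable_centered {A : Z → Mat d} (hA : Measurable A) (Abar : Mat d) :
    Measurable (centered A Abar) := by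
  unfold centered; fun_prop

theorem measurable_noise {A : Z → Mat d} {b : Z → Vec d} (hA : Measurable A) (hb : Measurable b)
    (Abar : Mat d) (bbar θ : Vec d) : Measurable (noise A b Abar bbar θ) := by
  unfold noise
  have h := measurable_centered hA Abar
  have hc : Continuous (fun q : Mat d => q θ) := by fun_prop
  have h2 : Measurable (fun z => centered A Abar z θ) := hc.measurable.comp h
  fun_prop

/-- The Markov kernel of `Y_t = (Z_{t+1}, J_t^{(0)}, J_t^{(1)}, J_t^{(2)})`: from
`(z, j₀, j₁, j₂)` the `J`-components move by the recursions driven by `z`, and the first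
component moves to a point drawn from `Q(z, ·)`. -/
def kernelJ2 (Q : Kernel Z Z) (α : ℝ) (Abar : Mat d) {At : Z → Mat d} {e : Z → Vec d}
    (hAt : Measurable At) (he : Measurable e) :
    Kernel (Z × Vec d × Vec d × Vec d) (Z × Vec d × Vec d × Vec d) :=
  (Q.comap Prod.fst measurable_fst) ×ₖ
    (Kernel.deterministic (stepJ α Abar At e) (measurable_stepJ α Abar hAt he))

/-- `E[Ã(X_{k+i+1}) Ã(X_{i+1}) ε(X_0)]`, where `X` is the stationary chain. -/
def corrTerm {Ω : Type*} [MeasurableSpace Ω] (P : Measure Ω) (X : ℕ → Ω → Z) (At : Z → Mat d)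
    (e : Z → Vec d) (k i : ℕ) : Vec d :=
  ∫ ω, At (X (k + i + 1) ω) (At (X (i + 1) ω) (e (X 0 ω))) ∂P

/-- `Δ₂ = - Abar⁻¹ ∑_{k ≥ 1} ∑_{i ≥ 0} E[Ã(X_{k+i+1}) Ã(X_{i+1}) ε(X_0)]`, `X` the stationary
chain (the first sum is indexed by `k - 1`). -/
def Delta2 {Ω : Type*} [MeasurableSpace Ω] (P : Measure Ω) (X : ℕ → Ω → Z) (Abar : Mat d)
    (At : Z → Mat d) (e : Z → Vec d) : Vec d :=
  -(Abar.inverse (∑' k : ℕ, ∑' i : ℕ, corrTerm P X At e (k + 1) i))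

end Expansion

end LSA

end

set_option linter.unusedSectionVars false

open scoped ENNReal

/-! The chain `(Z_{n+1}, J_n)` is a skew product: the base moves by `Q`, and the fibre moves by a
map `st (z, ·)` that is affine and lower triangular with diagonal blocks `B = 1 - α • Abar`. The
Lyapunov equation makes `B` a strict contraction of `‖·‖_S` for small `α`. If `J⁰` and `J¹` get
large weights, all fibre maps contract one seminorm `N` uniformly and preserve an `N`-ball
(`exists_isContractive_stepJ`).

Uniqueness and convergence: every invariant probability lives on the ball (`ae_ball_of_invariant`).
There the contraction turns a Lipschitz test function into almost a function of the base alone, and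
the mixing of `Q` does the rest (`IsLawSeq.tendsto_integral`, `eq_of_invariant`). Since linear
functions are bounded on the ball, the same argument gives the limit of `E[J_n⁽²⁾]`. Existence: run
the stationary chain backwards and compose the fibre maps along the infinite past; the limit exists
by contraction and its law is invariant (`exists_invariant`).

Bias: the stationary mean of the recursion for `J²` gives `Abar E[J²] = -E[Ã(Z) J¹]`. Using
invariance repeatedly removes first `J¹` and then `J⁰`, and yields `E[Ã(Z) J¹] = α² ∑_{k,i}
c_{k,i}(B^k, B^i)`, where `c_{k,i}(M, N)` is the stationary mean of `Ã(Z_{k+i+2}) M Ã(Z_{i+1}) N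
ε(Z_0)` (`integral_proj1_eq_tsum_corr`). Replacing both powers by `1` gives `-Abar Δ₂`. Because `Ã`
and `ε` are centred, `c_{k,i}` is bounded by the product of the mixing rates at `k+1` and `i+1`
(`norm_corr_le`), while `‖B^k - 1‖ ≤ (1 + α C_A)^k - 1`. The mixing rates beat this growth when `α
C_A t_mix ≤ 1/8`, and the total error is of order `α³ t_mix³` (`summable_and_tsum_mixRate_le`),
which is within the stated `α^{5/2} t_mix⁴`. -/

namespace LSA

/-! ### Total variation and the Dobrushin coefficient -/

section TotalVariation

variable {Z : Type*} [MeasurableSpace Z] {F : Type*} [NormedAddCommGroup F]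

theorem integrable_of_norm_le {μ : Measure Z} [IsFiniteMeasure μ] {f : Z → F} {C : ℝ}
    (hf : StronglyMeasurable f) (hC : ∀ z, ‖f z‖ ≤ C) : Integrable f μ :=
  Integrable.of_bound hf.aestronglyMeasurable C (Eventually.of_forall hC)

variable [NormedSpace ℝ F]

theorem norm_integral_le_of_norm_le_prob {μ : Measure Z} [IsProbabilityMeasure μ] {f : Z → F}
    {C : ℝ} (hC : ∀ᵐ z ∂μ, ‖f z‖ ≤ C) : ‖∫ z, f z ∂μ‖ ≤ C := by
  simpa using norm_integral_le_of_norm_le_const hC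

/-- The Jordan decomposition of `μ - ν`, rearranged into an identity of positive measures, so that
ordinary integrals can be compared on both sides. -/
theorem add_negPart_eq_add_posPart (μ ν : Measure Z) [IsFiniteMeasure μ] [IsFiniteMeasure ν] :
    μ + (μ.toSignedMeasure - ν.toSignedMeasure).toJordanDecomposition.negPart =
      ν + (μ.toSignedMeasure - ν.toSignedMeasure).toJordanDecomposition.posPart := by
  refine Measure.ext fun s hs => ?_
  have h := SignedMeasure.apply_eq_posPart_real_sub_negPart_real
    (μ.toSignedMeasure - ν.toSignedMeasure) hs
  rw [sub_apply, Measure.toSignedMeasure_apply_measurable hs,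
    Measure.toSignedMeasure_apply_measurable hs] at h
  rw [← ENNReal.toReal_eq_toReal_iff' (by finiteness) (by finiteness)]
  change (_ : Measure Z).real s = (_ : Measure Z).real s
  rw [measureReal_add_apply, measureReal_add_apply]
  linarith

theorem norm_integral_sub_integral_le_tvNorm {μ ν : Measure Z} [IsFiniteMeasure μ]
    [IsFiniteMeasure ν] {f : Z → F} {C : ℝ} (hf : StronglyMeasurable f) (hC : ∀ z, ‖f z‖ ≤ C) :
    ‖∫ z, f z ∂μ - ∫ z, f z ∂ν‖ ≤ C * tvNorm μ ν := by
  set j := (μ.toSignedMeasure - ν.toSignedMeasure).toJordanDecomposition with hj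
  have hi : ∀ (m : Measure Z) [IsFiniteMeasure m], Integrable f m :=
    fun m _ => integrable_of_norm_le hf hC
  have h := congrArg (fun m => ∫ z, f z ∂m) (add_negPart_eq_add_posPart μ ν)
  simp only [← hj] at h
  rw [integral_add_measure (hi _) (hi _), integral_add_measure (hi _) (hi _)] at h
  have h2 : ∫ z, f z ∂μ - ∫ z, f z ∂ν = ∫ z, f z ∂j.posPart - ∫ z, f z ∂j.negPart := by
    rw [sub_eq_sub_iff_add_eq_add, h, add_comm]
  have hb : ∀ (m : Measure Z) [IsFiniteMeasure m], ‖∫ z, f z ∂m‖ ≤ C * m.real Set.univ :=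
    fun m _ => norm_integral_le_of_norm_le_const (Eventually.of_forall hC)
  have h3 : tvNorm μ ν = j.posPart.real Set.univ + j.negPart.real Set.univ := by
    rw [← measureReal_add_apply]; rfl
  rw [h2, h3, mul_add]
  exact (norm_sub_le _ _).trans (add_le_add (hb _) (hb _))

/-- On a Hahn set `i` the two parts have masses `μ(i) - ν(i)` and `ν(iᶜ) - μ(iᶜ)`, each at most one.
The bound shows that the real supremum defining `dobrushin` is a true one and not a default value.
-/
theorem tvNorm_le (μ ν : Measure Z) [IsProbabilityMeasure μ] [IsProbabilityMeasure ν] :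
    tvNorm μ ν ≤ 2 := by
  set s := μ.toSignedMeasure - ν.toSignedMeasure with hs
  obtain ⟨i, hi, h1, h2, hp, hn⟩ := s.toJordanDecomposition_spec
  have h3 : tvNorm μ ν = s.toJordanDecomposition.posPart.real Set.univ +
      s.toJordanDecomposition.negPart.real Set.univ := by
    rw [← measureReal_add_apply]; rfl
  have hsi : ∀ A, MeasurableSet A → s A = μ.real A - ν.real A := fun A hA => by
    rw [hs, sub_apply, Measure.toSignedMeasure_apply_measurable hA,
      Measure.toSignedMeasure_apply_measurable hA]
  have e1 : s.toJordanDecomposition.posPart.real Set.univ = s i := by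
    rw [hp, SignedMeasure.toMeasureOfZeroLE_real_apply _ _ _ MeasurableSet.univ, Set.inter_univ]
  have e2 : s.toJordanDecomposition.negPart.real Set.univ = - s iᶜ := by
    rw [hn, SignedMeasure.toMeasureOfLEZero_real_apply _ _ _ MeasurableSet.univ, Set.inter_univ]
  rw [h3, e1, e2, hsi _ hi, hsi _ hi.compl]
  have := measureReal_le_one (μ := μ) (s := i)
  have := measureReal_le_one (μ := ν) (s := iᶜ)
  have := measureReal_nonneg (μ := ν) (s := i)
  have := measureReal_nonneg (μ := μ) (s := iᶜ)
  linarith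

theorem tvNorm_le_dobrushin (K : Kernel Z Z) [IsMarkovKernel K] (z z' : Z) :
    tvNorm (K z) (K z') ≤ 2 * dobrushin K := by
  have hb : BddAbove (Set.range fun p : Z × Z => (1 / 2 : ℝ) * tvNorm (K p.1) (K p.2)) :=
    ⟨1, by rintro _ ⟨p, rfl⟩; have := tvNorm_le (K p.1) (K p.2); dsimp only; linarith⟩
  have := le_ciSup hb (z, z')
  change (1 / 2 : ℝ) * tvNorm (K z) (K z') ≤ dobrushin K at this
  linarith

end TotalVariation

/-! ### Averages under powers of a kernel -/

section KernelIntegral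

variable {Z : Type*} [MeasurableSpace Z] {F : Type*} [NormedAddCommGroup F] [NormedSpace ℝ F]

/-- The function `z ↦ ∫ g dQⁿ(z, ·)`. -/
noncomputable def avg (Q : Kernel Z Z) (n : ℕ) (g : Z → F) (z : Z) : F := ∫ w, g w ∂((Q ^ n) z)

variable {Q : Kernel Z Z} [IsMarkovKernel Q] {g : Z → F} {C : ℝ}

theorem stronglyMeasurable_avg (n : ℕ) (hg : StronglyMeasurable g) :
    StronglyMeasurable (avg Q n g) :=
  StronglyMeasurable.integral_kernel_prod_right (κ := Q ^ n) (f := fun _ w => g w)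
    (hg.comp_measurable measurable_snd)

theorem norm_avg_le (n : ℕ) (hC : ∀ z, ‖g z‖ ≤ C) (z : Z) : ‖avg Q n g z‖ ≤ C :=
  norm_integral_le_of_norm_le_prob (Eventually.of_forall hC)

theorem integral_bind_kernel {Y : Type*} [MeasurableSpace Y] {κ : Kernel Z Y} [IsMarkovKernel κ]
    {μ : Measure Z} [IsProbabilityMeasure μ] {f : Y → F} (hf : Integrable f (μ.bind κ)) :
    ∫ y, f y ∂(μ.bind κ) = ∫ z, ∫ y, f y ∂(κ z) ∂μ := by
  have h : μ.bind κ = (κ ∘ₖ Kernel.const Unit μ) () := Measure.comp_eq_comp_const_apply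
  rw [h, Kernel.integral_comp (h ▸ hf), Kernel.const_apply]

variable [CompleteSpace F]

theorem avg_zero (hg : StronglyMeasurable g) : avg Q 0 g = g := by
  funext z
  rw [avg, pow_zero]
  exact integral_dirac' _ _ hg

omit [CompleteSpace F] in
theorem avg_avg (m n : ℕ) (hg : StronglyMeasurable g) (hC : ∀ z, ‖g z‖ ≤ C) :
    avg Q m (avg Q n g) = avg Q (n + m) g := by
  funext z
  have h : Q ^ (n + m) = (Q ^ n) ∘ₖ (Q ^ m) := pow_add Q n m
  have hm : IsMarkovKernel ((Q ^ n) ∘ₖ (Q ^ m)) := inferInstance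
  rw [avg, avg, h, Kernel.integral_comp (integrable_of_norm_le hg hC)]
  rfl

theorem integral_avg_of_invariant {π : Measure Z} [IsProbabilityMeasure π] (hπ : Q.Invariant π)
    (n : ℕ) (hg : StronglyMeasurable g) (hC : ∀ z, ‖g z‖ ≤ C) :
    ∫ z, avg Q n g z ∂π = ∫ z, g z ∂π := by
  induction n with
  | zero => rw [avg_zero hg]
  | succ n ih =>
    have h1 : ∫ z, avg Q n g z ∂(π.bind Q) = ∫ z, avg Q 1 (avg Q n g) z ∂π := by
      rw [integral_bind_kernel (by
        rw [hπ.def]; exact integrable_of_norm_le (stronglyMeasurable_avg n hg) (norm_avg_le n hC))]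
      simp only [avg, pow_one]
    rw [hπ.def, avg_avg 1 n hg hC] at h1
    rw [← h1, ih]

/-- Invariance turns `∫ g dπ` into `∫ Qⁿg dπ`, so the difference is a `π`-average over `w` of
`Qⁿg(z) - Qⁿg(w)`, and each of these is controlled by the Dobrushin coefficient. -/
theorem norm_avg_sub_integral_le {π : Measure Z} [IsProbabilityMeasure π] (hπ : Q.Invariant π)
    {n : ℕ} {r : ℝ} (hr : dobrushin (Q ^ n) ≤ r) (hg : StronglyMeasurable g)
    (hC : ∀ z, ‖g z‖ ≤ C) (z : Z) : ‖avg Q n g z - ∫ w, g w ∂π‖ ≤ 2 * C * r := by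
  have hC0 : 0 ≤ C := (norm_nonneg _).trans (hC z)
  rw [← integral_avg_of_invariant hπ n hg hC]
  have h : avg Q n g z - ∫ w, avg Q n g w ∂π = ∫ w, (avg Q n g z - avg Q n g w) ∂π := by
    rw [integral_sub (integrable_const _)
      (integrable_of_norm_le (stronglyMeasurable_avg n hg) (norm_avg_le n hC))]
    simp
  rw [h]
  refine norm_integral_le_of_norm_le_prob (Eventually.of_forall fun w => ?_)
  calc _ ≤ C * tvNorm ((Q ^ n) z) ((Q ^ n) w) := norm_integral_sub_integral_le_tvNorm hg hC
    _ ≤ C * (2 * r) := by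
      gcongr; exact (tvNorm_le_dobrushin _ z w).trans (by linarith)
    _ = _ := by ring

end KernelIntegral

/-! ### Contracting skew products: convergence and support of invariant laws -/

section SkewProduct

variable {Z : Type*} [MeasurableSpace Z] {E : Type*} [NormedAddCommGroup E] [NormedSpace ℝ E]
  [MeasurableSpace E] {F : Type*} [NormedAddCommGroup F] [NormedSpace ℝ F]

/-- The kernel `(z, u) ↦ law of (w, st (z, u))` with `w` drawn from `Q(z, ·)`. -/
noncomputable def skewKernel (Q : Kernel Z Z) (st : Z × E → E) (hst : Measurable st) :
    Kernel (Z × E) (Z × E) :=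
  (Q.comap Prod.fst measurable_fst) ×ₖ (Kernel.deterministic st hst)

/-- The maps `st (z, ·)` are uniform `N`-contractions that preserve the `N`-ball of radius `r`. -/
structure IsContractive (st : Z × E → E) (N : Seminorm ℝ E) (β r : ℝ) : Prop where
  beta_nonneg : 0 ≤ β
  beta_lt_one : β < 1
  radius_nonneg : 0 ≤ r
  contract : ∀ z u v, N (st (z, u) - st (z, v)) ≤ β * N (u - v)
  bound : ∀ z, N (st (z, 0)) ≤ (1 - β) * r
  cont : Continuous N
  exists_norm_le : ∃ c, ∀ u, ‖u‖ ≤ c * N u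

/-- Functions that are bounded by `C`, and `N`-Lipschitz in the second variable with constant `L`,
on the `N`-ball of radius `r`. -/
structure IsTest (N : Seminorm ℝ E) (r : ℝ) (f : Z × E → F) (C L : ℝ) : Prop where
  meas : StronglyMeasurable f
  nonneg : 0 ≤ L
  bound : ∀ z u, N u ≤ r → ‖f (z, u)‖ ≤ C
  lip : ∀ z u v, N u ≤ r → N v ≤ r → ‖f (z, u) - f (z, v)‖ ≤ L * N (u - v)

/-- The action of `skewKernel Q st` on functions. -/
noncomputable def skewOp (Q : Kernel Z Z) (st : Z × E → E) (f : Z × E → F) (p : Z × E) : F :=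
  ∫ w, f (w, st p) ∂(Q p.1)

variable {Q : Kernel Z Z} {st : Z × E → E} {N : Seminorm ℝ E} {β r : ℝ} {f : Z × E → F} {C L : ℝ}

/-- The right-hand side has fixed point `r`: the ball of radius `r` is preserved, and outside it the
excess `N u - r` shrinks by the factor `β`. -/
theorem IsContractive.apply_le (hc : IsContractive st N β r) (z : Z) (u : E) :
    N (st (z, u)) ≤ β * N u + (1 - β) * r := by
  have h1 := hc.contract z u 0
  have h2 := map_add_le_add N (st (z, u) - st (z, 0)) (st (z, 0))
  rw [sub_add_cancel] at h2
  rw [sub_zero] at h1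
  linarith [hc.bound z]

theorem IsContractive.apply_mem (hc : IsContractive st N β r) (z : Z) {u : E} (hu : N u ≤ r) :
    N (st (z, u)) ≤ r := by
  have := hc.apply_le z u
  nlinarith [hc.beta_nonneg]

variable [IsMarkovKernel Q]

instance (hst : Measurable st) : IsMarkovKernel (skewKernel Q st hst) := by
  unfold skewKernel; infer_instance

theorem skewKernel_apply (hst : Measurable st) (p : Z × E) :
    skewKernel Q st hst p = (Q p.1).map (fun w => (w, st p)) := by
  rw [skewKernel, Kernel.prod_apply, Kernel.deterministic_apply, Kernel.comap_apply,
    Measure.prod_dirac]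

theorem integral_skewKernel (hst : Measurable st) (hf : StronglyMeasurable f) (p : Z × E) :
    ∫ q, f q ∂(skewKernel Q st hst p) = skewOp Q st f p := by
  rw [skewKernel_apply, integral_map (by fun_prop) hf.aestronglyMeasurable]
  rfl

theorem IsTest.integrable {μ : Measure (Z × E)} [IsProbabilityMeasure μ] (hf : IsTest N r f C L)
    (hμ : ∀ᵐ p ∂μ, N p.2 ≤ r) : Integrable f μ :=
  Integrable.of_bound hf.meas.aestronglyMeasurable C
    (hμ.mono fun p hp => hf.bound p.1 p.2 hp)

/-- Two fibre points over the same `z` are moved with the same draw `w`, so the fibre contraction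
passes to the Lipschitz constant. This factor `β` is how the fibre is forgotten. -/
theorem IsTest.skewOp (hc : IsContractive st N β r) (hst : Measurable st)
    (hf : IsTest N r f C L) : IsTest N r (skewOp Q st f) C (β * L) := by
  have hi : ∀ z u, N u ≤ r → Integrable (fun w => f (w, u)) (Q z) := fun z u hu =>
    integrable_of_norm_le (hf.meas.comp_measurable (by fun_prop)) (fun w => hf.bound w u hu)
  refine ⟨?_, mul_nonneg hc.beta_nonneg hf.nonneg, ?_, ?_⟩
  · exact StronglyMeasurable.integral_kernel_prod_right
      (κ := Q.comap Prod.fst measurable_fst) (f := fun (p : Z × E) w => f (w, st p))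
      (hf.meas.comp_measurable (by fun_prop))
  · exact fun z u hu => norm_integral_le_of_norm_le_prob
      (Eventually.of_forall fun w => hf.bound w _ (hc.apply_mem z hu))
  · intro z u v hu hv
    have h1 := hc.apply_mem z hu
    have h2 := hc.apply_mem z hv
    unfold LSA.skewOp
    rw [← integral_sub (hi z _ h1) (hi z _ h2)]
    refine norm_integral_le_of_norm_le_prob (Eventually.of_forall fun w => ?_)
    refine (hf.lip w _ _ h1 h2).trans ?_
    calc _ ≤ L * (β * N (u - v)) := mul_le_mul_of_nonneg_left (hc.contract z u v) hf.nonneg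
      _ = _ := by ring

theorem IsTest.iterate_skewOp (hc : IsContractive st N β r) (hst : Measurable st)
    (hf : IsTest N r f C L) (n : ℕ) : IsTest N r ((LSA.skewOp Q st)^[n] f) C (β ^ n * L) := by
  induction n with
  | zero => simpa using hf
  | succ n ih =>
    rw [Function.iterate_succ_apply']
    have := ih.skewOp (Q := Q) hc hst
    rwa [← mul_assoc, ← pow_succ'] at this

variable [BorelSpace E]

theorem measurableSet_ball (hN : Continuous N) (s : ℝ) : MeasurableSet {p : Z × E | N p.2 ≤ s} :=
  measurableSet_le (hN.measurable.comp measurable_snd) measurable_const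

theorem ae_ball_bind (hc : IsContractive st N β r) (hst : Measurable st) {μ : Measure (Z × E)}
    (hμ : ∀ᵐ p ∂μ, N p.2 ≤ r) : ∀ᵐ p ∂(μ.bind (skewKernel Q st hst)), N p.2 ≤ r := by
  refine Measure.ae_comp_of_ae_ae (measurableSet_ball hc.cont r) (hμ.mono fun p hp => ?_)
  rw [skewKernel_apply, ae_map_iff (by fun_prop) (measurableSet_ball hc.cont r)]
  exact Eventually.of_forall fun w => hc.apply_mem p.1 hp

theorem integral_bind_skewKernel (hc : IsContractive st N β r) (hst : Measurable st)
    {μ : Measure (Z × E)} [IsProbabilityMeasure μ] (hμ : ∀ᵐ p ∂μ, N p.2 ≤ r)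
    (hf : IsTest N r f C L) :
    ∫ p, f p ∂(μ.bind (skewKernel Q st hst)) = ∫ p, skewOp Q st f p ∂μ := by
  have : IsProbabilityMeasure (μ.bind (skewKernel Q st hst)) :=
    inferInstanceAs (IsProbabilityMeasure (skewKernel Q st hst ∘ₘ μ))
  rw [integral_bind_kernel (hf.integrable (ae_ball_bind hc hst hμ))]
  exact integral_congr_ae (Eventually.of_forall fun p => integral_skewKernel hst hf.meas p)

/-- A sequence of laws that evolves by `skewKernel Q st` and starts in the `N`-ball of
radius `r`. -/
structure IsLawSeq (Q : Kernel Z Z) (st : Z × E → E) (hst : Measurable st) (N : Seminorm ℝ E)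
    (r : ℝ) (μ : ℕ → Measure (Z × E)) : Prop where
  prob : ∀ n, IsProbabilityMeasure (μ n)
  ball : ∀ᵐ p ∂(μ 0), N p.2 ≤ r
  succ : ∀ n, μ (n + 1) = (μ n).bind (skewKernel Q st hst)

variable {hst : Measurable st} {μ : ℕ → Measure (Z × E)}

theorem IsLawSeq.ae_ball (hμ : IsLawSeq Q st hst N r μ) (hc : IsContractive st N β r) (n : ℕ) :
    ∀ᵐ p ∂(μ n), N p.2 ≤ r := by
  induction n with
  | zero => exact hμ.ball
  | succ n ih => rw [hμ.succ]; exact ae_ball_bind hc hst ih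

theorem IsLawSeq.integral_add (hμ : IsLawSeq Q st hst N r μ) (hc : IsContractive st N β r)
    (hf : IsTest N r f C L) (m n : ℕ) :
    ∫ p, f p ∂(μ (m + n)) = ∫ p, (skewOp Q st)^[n] f p ∂(μ m) := by
  induction n generalizing f L with
  | zero => rfl
  | succ n ih =>
    have := hμ.prob (m + n)
    rw [← add_assoc, hμ.succ, integral_bind_skewKernel hc hst (hμ.ae_ball hc _) hf,
      ih (hf.skewOp hc hst)]
    rfl

variable [CompleteSpace F]

theorem iterate_skewOp_comp_fst {g : Z → F} (hg : StronglyMeasurable g) (hC : ∀ z, ‖g z‖ ≤ C)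
    (n : ℕ) : (skewOp Q st)^[n] (fun p => g p.1) = fun p => avg Q n g p.1 := by
  induction n with
  | zero => rw [avg_zero hg]; rfl
  | succ n ih =>
    rw [Function.iterate_succ_apply', ih, ← avg_avg 1 n hg hC]
    funext p
    simp only [skewOp, avg, pow_one]

variable {π : Measure Z} [IsProbabilityMeasure π]

theorem IsLawSeq.norm_integral_fst_sub_le (hμ : IsLawSeq Q st hst N r μ)
    (hc : IsContractive st N β r) (hπ : Q.Invariant π) {g : Z → F} (hg : StronglyMeasurable g)
    (hC : ∀ z, ‖g z‖ ≤ C) {n : ℕ} {s : ℝ} (hs : dobrushin (Q ^ n) ≤ s) :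
    ‖∫ p, g p.1 ∂(μ n) - ∫ z, g z ∂π‖ ≤ 2 * C * s := by
  have ht : IsTest N r (fun p : Z × E => g p.1) C 0 :=
    ⟨hg.comp_measurable measurable_fst, le_rfl, fun z _ _ => hC z, fun z u v _ _ => by simp⟩
  have h := hμ.integral_add hc ht 0 n
  have := hμ.prob 0
  rw [zero_add, iterate_skewOp_comp_fst hg hC] at h
  rw [h]
  have h2 : ∫ p : Z × E, avg Q n g p.1 ∂(μ 0) - ∫ z, g z ∂π =
      ∫ p : Z × E, (avg Q n g p.1 - ∫ z, g z ∂π) ∂(μ 0) := by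
    rw [integral_sub _ (integrable_const _)]
    · simp
    · exact integrable_of_norm_le ((stronglyMeasurable_avg n hg).comp_measurable measurable_fst)
        (fun p => norm_avg_le n hC p.1)
  rw [h2]
  exact norm_integral_le_of_norm_le_prob
    (Eventually.of_forall fun p => norm_avg_sub_integral_le hπ hs hg hC p.1)

/-- The last `n` steps, moved onto `f`, make it almost independent of the fibre, so that setting the
fibre to `0` costs `β ^ n * L * r`; the first `m` steps bring the base close to `π`. The reference
value does not depend on the initial law, so two law sequences can be compared through it. -/
theorem IsLawSeq.norm_integral_sub_le (hμ : IsLawSeq Q st hst N r μ)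
    (hc : IsContractive st N β r) (hπ : Q.Invariant π) (hf : IsTest N r f C L)
    (m n : ℕ) {s : ℝ} (hs : dobrushin (Q ^ m) ≤ s) :
    ‖∫ p, f p ∂(μ (m + n)) - ∫ z, (skewOp Q st)^[n] f (z, 0) ∂π‖ ≤
      β ^ n * L * r + 2 * C * s := by
  have ht := hf.iterate_skewOp (Q := Q) hc hst n
  have := hμ.prob m
  have h0 : N 0 ≤ r := by simpa using hc.radius_nonneg
  set g : Z → F := fun z => (skewOp Q st)^[n] f (z, 0) with hg
  have hgm : StronglyMeasurable g := ht.meas.comp_measurable (by fun_prop)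
  have hgC : ∀ z, ‖g z‖ ≤ C := fun z => ht.bound z 0 h0
  have hgi : Integrable (fun p : Z × E => g p.1) (μ m) :=
    integrable_of_norm_le (hgm.comp_measurable measurable_fst) (fun p => hgC p.1)
  rw [hμ.integral_add hc hf]
  have h1 : ‖∫ p, (skewOp Q st)^[n] f p ∂(μ m) - ∫ p, g p.1 ∂(μ m)‖ ≤ β ^ n * L * r := by
    rw [← integral_sub (ht.integrable (hμ.ae_ball hc m)) hgi]
    refine norm_integral_le_of_norm_le_prob ((hμ.ae_ball hc m).mono fun p hp => ?_)
    refine (ht.lip p.1 p.2 0 hp h0).trans ?_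
    rw [sub_zero]
    exact mul_le_mul_of_nonneg_left hp ht.nonneg
  have h2 := hμ.norm_integral_fst_sub_le hc hπ hgm hgC hs
  calc _ = ‖(∫ p, (skewOp Q st)^[n] f p ∂(μ m) - ∫ p, g p.1 ∂(μ m)) +
        (∫ p, g p.1 ∂(μ m) - ∫ z, g z ∂π)‖ := by rw [sub_add_sub_cancel]
    _ ≤ _ := (norm_add_le _ _).trans (add_le_add h1 h2)

theorem isLawSeq_const {Pi : Measure (Z × E)} [IsProbabilityMeasure Pi]
    (hPi : (skewKernel Q st hst).Invariant Pi) (hb : ∀ᵐ p ∂Pi, N p.2 ≤ r) :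
    IsLawSeq Q st hst N r (fun _ => Pi) :=
  ⟨fun _ => inferInstance, hb, fun _ => hPi.def.symm⟩

/-- After `k` steps `μ` and the constant sequence `Pi` are both close to the same reference value:
half of the steps are spent on mixing and the other half on contraction. -/
theorem IsLawSeq.tendsto_integral (hμ : IsLawSeq Q st hst N r μ)
    (hc : IsContractive st N β r) (hπ : Q.Invariant π) {s : ℕ → ℝ}
    (hs : ∀ n, 1 ≤ n → dobrushin (Q ^ n) ≤ s n) (hs0 : Tendsto s atTop (𝓝 0))
    {Pi : Measure (Z × E)} [IsProbabilityMeasure Pi] (hPi : (skewKernel Q st hst).Invariant Pi)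
    (hb : ∀ᵐ p ∂Pi, N p.2 ≤ r) (hf : IsTest N r f C L) :
    Tendsto (fun n => ∫ p, f p ∂(μ n)) atTop (𝓝 (∫ p, f p ∂Pi)) := by
  rw [tendsto_iff_norm_sub_tendsto_zero]
  have hd : Tendsto (fun k : ℕ => k / 2) atTop atTop := Nat.tendsto_div_const_atTop two_ne_zero
  have hd2 : Tendsto (fun k : ℕ => k - k / 2) atTop atTop :=
    tendsto_atTop_mono (fun k => by omega) hd
  have hlim : Tendsto (fun k : ℕ => 2 * (β ^ (k - k / 2) * L * r + 2 * C * s (k / 2))) atTop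
      (𝓝 (2 * (0 * L * r + 2 * C * 0))) :=
    (((((tendsto_pow_atTop_nhds_zero_of_lt_one hc.beta_nonneg hc.beta_lt_one).comp
      hd2).mul_const L).mul_const r).add ((hs0.comp hd).const_mul _)).const_mul 2
  simp only [zero_mul, mul_zero, add_zero] at hlim
  refine squeeze_zero' (Eventually.of_forall fun _ => norm_nonneg _) ?_ hlim
  -- For `k ≥ 2` the mixing half `k / 2` is at least one, as `hs` requires.
  filter_upwards [eventually_ge_atTop 2] with k hk
  have h1 : dobrushin (Q ^ (k / 2)) ≤ s (k / 2) := hs _ (by omega)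
  have h2 := hμ.norm_integral_sub_le hc hπ hf (k / 2) (k - k / 2) h1
  have h3 := (isLawSeq_const hPi hb).norm_integral_sub_le hc hπ hf (k / 2) (k - k / 2) h1
  rw [show k / 2 + (k - k / 2) = k by omega] at h2
  rw [norm_sub_rev] at h3
  calc _ ≤ _ := norm_sub_le_norm_sub_add_norm_sub _ _ _
    _ ≤ _ := add_le_add h2 h3
    _ = _ := by ring

-- One step multiplies `N - r` by at most `β`, so a point that lands in the `n`-th set starts in the
-- `(n+1)`-st; invariance of `Pi` turns this inclusion into an inequality of measures.
omit [CompleteSpace F] in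
theorem measure_lt_le_of_invariant (hc : IsContractive st N β r) {Pi : Measure (Z × E)}
    [IsProbabilityMeasure Pi] (hPi : (skewKernel Q st hst).Invariant Pi) (t : ℝ) (n : ℕ) :
    Pi {p | t < N p.2 - r} ≤ Pi {p | t < β ^ n * (N p.2 - r)} := by
  have hmeas : ∀ b : ℝ, MeasurableSet {p : Z × E | t < b * (N p.2 - r)} := fun b => by
    have := hc.cont.measurable
    exact measurableSet_lt measurable_const (by fun_prop)
  induction n with
  | zero => simp
  | succ n ih =>
    refine ih.trans ?_
    have hn := pow_nonneg hc.beta_nonneg n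
    conv_lhs => rw [← hPi.def]
    rw [Measure.bind_apply (hmeas _) (Kernel.aemeasurable _)]
    calc _ ≤ ∫⁻ p, Set.indicator {p : Z × E | t < β ^ (n + 1) * (N p.2 - r)} 1 p ∂Pi := by
          refine lintegral_mono fun p => ?_
          rw [skewKernel_apply, Measure.map_apply (by fun_prop) (hmeas _)]
          by_cases hp : t < β ^ (n + 1) * (N p.2 - r)
          · rw [Set.indicator_of_mem (by exact hp)]
            exact prob_le_one
          · rw [Set.indicator_of_notMem (by exact hp)]
            refine le_of_eq ?_
            convert! measure_empty (μ := Q p.1)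
            refine Set.eq_empty_of_forall_notMem fun w hw => hp ?_
            change t < β ^ n * (N (st p) - r) at hw
            refine hw.trans_le ?_
            have h1 : N (st p) - r ≤ β * (N p.2 - r) := by
              have := hc.apply_le p.1 p.2
              simp only [Prod.mk.eta] at this
              linarith
            calc _ ≤ β ^ n * (β * (N p.2 - r)) := by gcongr
              _ = _ := by ring
      _ = _ := by rw [lintegral_indicator_one (hmeas _)]

/-- For `t > 0` the sets `{t < β ^ n * (N - r)}` decrease to the empty set, yet each has at least
the measure of the set for `n = 0`. No moment assumption on `Pi` enters, so uniqueness holds among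
all invariant probabilities. -/
theorem ae_ball_of_invariant (hc : IsContractive st N β r) {Pi : Measure (Z × E)}
    [IsProbabilityMeasure Pi] (hPi : (skewKernel Q st hst).Invariant Pi) :
    ∀ᵐ p ∂Pi, N p.2 ≤ r := by
  have key : ∀ t : ℝ, 0 < t → Pi {p | t < N p.2 - r} = 0 := by
    intro t ht
    have hmeas : ∀ b : ℝ, MeasurableSet {p : Z × E | t < b * (N p.2 - r)} := fun b => by
      have := hc.cont.measurable
      exact measurableSet_lt measurable_const (by fun_prop)
    have hanti : Antitone fun n : ℕ => {p : Z × E | t < β ^ n * (N p.2 - r)} := by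
      refine antitone_nat_of_succ_le fun n p hp => ?_
      have hp' : t < β ^ (n + 1) * (N p.2 - r) := hp
      have h0 := pow_nonneg hc.beta_nonneg n
      have h1 := pow_nonneg hc.beta_nonneg (n + 1)
      have hpos : 0 < N p.2 - r := by
        by_contra hneg
        push Not at hneg
        nlinarith
      refine lt_of_lt_of_le hp' ?_
      gcongr ?_ * _
      exact pow_le_pow_of_le_one hc.beta_nonneg hc.beta_lt_one.le (Nat.le_succ n)
    have hlim := tendsto_measure_iInter_atTop (μ := Pi)
      (fun n => (hmeas (β ^ n)).nullMeasurableSet) hanti ⟨0, measure_ne_top _ _⟩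
    have hempty : (⋂ n : ℕ, {p : Z × E | t < β ^ n * (N p.2 - r)}) = ∅ := by
      refine Set.eq_empty_of_forall_notMem fun p hp => ?_
      have h1 : Tendsto (fun n : ℕ => β ^ n * (N p.2 - r)) atTop (𝓝 (0 * (N p.2 - r))) :=
        (tendsto_pow_atTop_nhds_zero_of_lt_one hc.beta_nonneg hc.beta_lt_one).mul_const _
      rw [zero_mul] at h1
      obtain ⟨n, hn⟩ := (h1.eventually (gt_mem_nhds ht)).exists
      exact lt_asymm hn (Set.mem_iInter.1 hp n)
    rw [hempty, measure_empty] at hlim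
    exact le_antisymm (ge_of_tendsto' hlim (measure_lt_le_of_invariant hc hPi t)) zero_le
  have h2 : ∀ k : ℕ, ∀ᵐ p ∂Pi, N p.2 - r ≤ 1 / ((k : ℝ) + 1) := fun k => by
    rw [ae_iff]
    simpa only [not_le] using key (1 / ((k : ℝ) + 1)) (by positivity)
  filter_upwards [ae_all_iff.2 h2] with p hp
  have := le_of_tendsto_of_tendsto' tendsto_const_nhds tendsto_one_div_add_atTop_nhds_zero_nat hp
  linarith

end SkewProduct

/-! ### Uniqueness of the invariant law -/

section Uniqueness

variable {Z : Type*} [MeasurableSpace Z] {E : Type*} [NormedAddCommGroup E] [NormedSpace ℝ E]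
  [MeasurableSpace E] [BorelSpace E] [SecondCountableTopology E] [CompleteSpace E]

/-- Rectangles `B ×ˢ D` determine the measure, and for fixed `B` the finite measure in `D` is
determined by its characteristic function. The separating functions are bounded and Lipschitz in the
fibre, hence belong to the test class. -/
theorem measure_ext_of_integral_indicator_exp {μ ν : Measure (Z × E)} [IsFiniteMeasure μ]
    [IsFiniteMeasure ν]
    (h : ∀ (B : Set Z), MeasurableSet B → ∀ ℓ : StrongDual ℝ E,
      ∫ p, B.indicator (fun _ => Complex.exp (ℓ p.2 * Complex.I)) p.1 ∂μ =
        ∫ p, B.indicator (fun _ => Complex.exp (ℓ p.2 * Complex.I)) p.1 ∂ν) : μ = ν := by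
  refine Measure.ext_prod fun {B D} hB hD => ?_
  have key : ∀ (m : Measure (Z × E)) [IsFiniteMeasure m] (ℓ : StrongDual ℝ E),
      charFunDual ((m.restrict (Prod.fst ⁻¹' B)).map Prod.snd) ℓ =
        ∫ p, B.indicator (fun _ => Complex.exp (ℓ p.2 * Complex.I)) p.1 ∂m := by
    intro m _ ℓ
    rw [charFunDual_apply, integral_map measurable_snd.aemeasurable (by fun_prop),
      ← integral_indicator (measurable_fst hB)]
    rfl
  have h2 : (μ.restrict (Prod.fst ⁻¹' B)).map Prod.snd =
      (ν.restrict (Prod.fst ⁻¹' B)).map Prod.snd := by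
    refine Measure.ext_of_charFunDual ?_
    ext ℓ
    rw [key, key, h B hB]
  have h3 := congrArg (fun m => m D) h2
  rw [Measure.map_apply measurable_snd hD, Measure.map_apply measurable_snd hD,
    Measure.restrict_apply (measurable_snd hD), Measure.restrict_apply (measurable_snd hD)] at h3
  rwa [Set.prod_eq, Set.inter_comm]

theorem norm_exp_sub_exp_le (a b : ℝ) :
    ‖Complex.exp (a * Complex.I) - Complex.exp (b * Complex.I)‖ ≤ |a - b| := by
  have h : Complex.exp (a * Complex.I) - Complex.exp (b * Complex.I) =
      Complex.exp (b * Complex.I) * (Complex.exp (Complex.I * ((a - b : ℝ) : ℂ)) - 1) := by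
    rw [mul_sub, ← Complex.exp_add, mul_one]
    congr 2
    push_cast; ring
  rw [h, norm_mul, Complex.norm_exp_ofReal_mul_I, one_mul]
  exact Real.norm_exp_I_mul_ofReal_sub_one_le

/-- The constant sequence `Pi'` is itself a law sequence, so its integrals against separating tests
converge to those of `Pi`; being constant, they are equal. -/
theorem eq_of_invariant {Q : Kernel Z Z} [IsMarkovKernel Q] {st : Z × E → E} {hst : Measurable st}
    {N : Seminorm ℝ E} {β r : ℝ} (hc : IsContractive st N β r)
    {π : Measure Z} [IsProbabilityMeasure π] (hπ : Q.Invariant π) {s : ℕ → ℝ}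
    (hs : ∀ n, 1 ≤ n → dobrushin (Q ^ n) ≤ s n) (hs0 : Tendsto s atTop (𝓝 0))
    {Pi Pi' : Measure (Z × E)} [IsProbabilityMeasure Pi] [IsProbabilityMeasure Pi']
    (hPi : (skewKernel Q st hst).Invariant Pi) (hPi' : (skewKernel Q st hst).Invariant Pi') :
    Pi' = Pi := by
  refine measure_ext_of_integral_indicator_exp fun B hB ℓ => ?_
  obtain ⟨c, hcN⟩ := hc.exists_norm_le
  have hc' : ∀ u, ‖u‖ ≤ |c| * N u := fun u =>
    (hcN u).trans (mul_le_mul_of_nonneg_right (le_abs_self c) (apply_nonneg _ _))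
  have hf : IsTest N r (fun p : Z × E =>
      B.indicator (fun _ => Complex.exp (ℓ p.2 * Complex.I)) p.1) 1 (‖ℓ‖ * |c|) := by
    refine ⟨?_, by positivity, fun z u _ => ?_, fun z u v _ _ => ?_⟩
    · have h1 : Measurable fun p : Z × E => Complex.exp (ℓ p.2 * Complex.I) := by fun_prop
      exact (h1.indicator (measurable_fst hB)).stronglyMeasurable
    · refine (norm_indicator_le_norm_self _ _).trans ?_
      rw [Complex.norm_exp_ofReal_mul_I]
    · have h0 : 0 ≤ ‖ℓ‖ * |c| * N (u - v) := by positivity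
      by_cases hz : z ∈ B
      · simp only [Set.indicator_of_mem hz]
        refine (norm_exp_sub_exp_le _ _).trans ?_
        rw [← map_sub, ← Real.norm_eq_abs]
        refine (ℓ.le_opNorm _).trans ?_
        rw [mul_assoc]
        gcongr
        exact hc' _
      · simpa only [Set.indicator_of_notMem hz, sub_zero, norm_zero] using h0
  have := (isLawSeq_const hPi' (ae_ball_of_invariant hc hPi')).tendsto_integral hc hπ hs hs0 hPi
    (ae_ball_of_invariant hc hPi) hf
  exact tendsto_nhds_unique tendsto_const_nhds this

end Uniqueness

/-! ### Path space and prepending a point to the reversed chain -/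

section Paths

variable {Z : Type*}

/-- Freeze a sequence after time `n`. -/
def trunc (n : ℕ) (y : ℕ → Z) (i : ℕ) : Z := y (min i n)

/-- Prepend a point to a sequence. -/
def consSeq (w : Z) (y : ℕ → Z) : ℕ → Z
  | 0 => w
  | i + 1 => y i

/-- Drop the first point of a sequence. -/
def tailSeq (y : ℕ → Z) (i : ℕ) : Z := y (i + 1)

/-- Replace all points of a sequence after time `n` by `v`. -/
def extSeq (n : ℕ) (y : ℕ → Z) (v : Z) (i : ℕ) : Z := if i ≤ n then y i else v

theorem trunc_succ_consSeq (n : ℕ) (w : Z) (y : ℕ → Z) :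
    trunc (n + 1) (consSeq w y) = consSeq w (trunc n y) := by
  funext i
  cases i with
  | zero => simp [trunc, consSeq]
  | succ i => simp [trunc, consSeq]

theorem extSeq_trunc (n : ℕ) (y : ℕ → Z) : extSeq n (trunc n y) (y (n + 1)) = trunc (n + 1) y := by
  funext i
  simp only [extSeq, trunc]
  split_ifs with h
  · rw [min_eq_left h, min_eq_left (by omega)]
  · rw [min_eq_right (by omega)]

theorem trunc_zero (n : ℕ) (y : ℕ → Z) : trunc n y 0 = y 0 := by simp [trunc]

theorem trunc_self (n : ℕ) (y : ℕ → Z) : trunc n y n = y n := by simp [trunc]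

theorem tailSeq_consSeq (w : Z) (y : ℕ → Z) : tailSeq (consSeq w y) = y := rfl

theorem consSeq_extSeq_tailSeq_trunc (n : ℕ) (y : ℕ → Z) :
    consSeq (y 0) (extSeq n (tailSeq (trunc (n + 1) y)) (y (n + 2))) = trunc (n + 2) y := by
  funext i
  cases i with
  | zero => simp [trunc, consSeq]
  | succ i =>
    simp only [consSeq, extSeq, tailSeq, trunc]
    split_ifs with h
    · rw [min_eq_left (by omega), min_eq_left (by omega)]
    · rw [min_eq_right (by omega)]

theorem consSeq_const_eq_trunc (y : ℕ → Z) : consSeq (y 0) (fun _ => y 1) = trunc 1 y := by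
  funext i
  cases i with
  | zero => simp [trunc, consSeq]
  | succ i => simp [trunc, consSeq]

variable [MeasurableSpace Z]

theorem measurable_trunc (n : ℕ) : Measurable (trunc n : (ℕ → Z) → ℕ → Z) :=
  measurable_pi_iff.2 fun _ => measurable_pi_apply _

theorem measurable_tailSeq : Measurable (tailSeq : (ℕ → Z) → ℕ → Z) :=
  measurable_pi_iff.2 fun _ => measurable_pi_apply _

theorem Measurable.consSeq {α : Type*} [MeasurableSpace α] {f : α → Z} {g : α → ℕ → Z}
    (hf : Measurable f) (hg : Measurable g) : Measurable fun a => consSeq (f a) (g a) :=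
  measurable_pi_iff.2 fun i => by
    cases i with
    | zero => exact hf
    | succ i => exact measurable_pi_iff.1 hg i

theorem Measurable.extSeq {α : Type*} [MeasurableSpace α] {f : α → Z} {g : α → ℕ → Z} (n : ℕ)
    (hf : Measurable f) (hg : Measurable g) : Measurable fun a => extSeq n (g a) (f a) :=
  measurable_pi_iff.2 fun i => by
    by_cases h : i ≤ n
    · simpa [LSA.extSeq, h] using measurable_pi_iff.1 hg i
    · simpa [LSA.extSeq, h] using hf

/-- The law of a Markov chain with kernel `R`, as a measure on paths. -/
def IsMarkovLaw (R : Kernel Z Z) (ν : Measure (ℕ → Z)) : Prop :=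
  ∀ (n : ℕ) (G : (ℕ → Z) × Z → ℝ≥0∞), Measurable G →
    ∫⁻ y, G (trunc n y, y (n + 1)) ∂ν = ∫⁻ y, ∫⁻ v, G (trunc n y, v) ∂(R (y n)) ∂ν

theorem measure_ext_of_map_trunc {μ ν : Measure (ℕ → Z)} [IsFiniteMeasure μ] [IsFiniteMeasure ν]
    (h : ∀ n, μ.map (trunc (n + 1)) = ν.map (trunc (n + 1))) : μ = ν := by
  have hfin : ∀ I : Finset ℕ, IsFiniteMeasure (ν.map I.restrict) := fun I => inferInstance
  refine IsProjectiveLimit.unique (P := fun I : Finset ℕ => ν.map I.restrict) (fun I => ?_)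
    (fun I => rfl)
  have h1 : ∀ ρ : Measure (ℕ → Z), ρ.map I.restrict =
      (ρ.map (trunc (I.sup id + 1))).map (I.restrict (π := fun _ => Z)) := fun ρ => by
    rw [Measure.map_map (Finset.measurable_restrict I) (measurable_trunc _)]
    congr 1
    funext y i
    have : i.1 ≤ I.sup id := Finset.le_sup (f := id) i.2
    simp only [Function.comp_apply, Finset.restrict, trunc]
    rw [min_eq_left (by omega)]
  exact (h1 μ).trans ((h _).symm ▸ (h1 ν).symm)

variable {Q R : Kernel Z Z} [IsMarkovKernel Q] [IsMarkovKernel R] {π : Measure Z}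
  [IsProbabilityMeasure π] {ν : Measure (ℕ → Z)} [IsProbabilityMeasure ν]

/-- `hR` says that `R` is the time reversal of `Q` under `π`. If `y` is a stationary `R`-chain and
`w` is drawn from `Q(y₀, ·)`, then `(w, y₀)` has law `π ⊗ₘ R`, and `w` is independent of the rest of
`y` given `y₀`; so `w, y₀, y₁, …` is again a stationary `R`-chain. The induction adds one coordinate
at the far end. -/
theorem IsMarkovLaw.lintegral_consSeq_trunc (hν : IsMarkovLaw R ν) (h0 : ν.map (fun y => y 0) = π)
    (hR : π ⊗ₘ R = (π ⊗ₘ Q).map Prod.swap) (n : ℕ) {F : (ℕ → Z) → ℝ≥0∞} (hF : Measurable F) :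
    ∫⁻ y, ∫⁻ w, F (consSeq w (trunc n y)) ∂(Q (y 0)) ∂ν = ∫⁻ y, F (trunc (n + 1) y) ∂ν := by
  have hm0 : Measurable fun y : ℕ → Z => y 0 := measurable_pi_apply 0
  induction n generalizing F with
  | zero =>
    have hA : Measurable fun p : Z × Z => F (consSeq p.1 (fun _ => p.2)) :=
      hF.comp (Measurable.consSeq measurable_fst (measurable_pi_iff.2 fun _ => measurable_snd))
    have e1 : ∫⁻ y, ∫⁻ w, F (consSeq w (trunc 0 y)) ∂(Q (y 0)) ∂ν =
        ∫⁻ z, ∫⁻ w, F (consSeq w (fun _ => z)) ∂(Q z) ∂π := by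
      rw [← h0, lintegral_map (Measurable.lintegral_kernel_prod_right' (κ := Q)
        (f := fun p : Z × Z => F (consSeq p.2 (fun _ => p.1))) (hA.comp measurable_swap)) hm0]
      have h1 : ∀ y : ℕ → Z, trunc 0 y = fun _ => y 0 := fun y => by funext i; simp [trunc]
      simp only [h1]
    have e2 : ∫⁻ z, ∫⁻ w, F (consSeq w (fun _ => z)) ∂(Q z) ∂π =
        ∫⁻ z, ∫⁻ v, F (consSeq z (fun _ => v)) ∂(R z) ∂π := by
      rw [← Measure.lintegral_compProd (f := fun p : Z × Z => F (consSeq p.1 (fun _ => p.2))) hA,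
        hR, lintegral_map hA measurable_swap]
      exact (Measure.lintegral_compProd (hA.comp measurable_swap)).symm
    have e3 := hν 0 (fun p => F (consSeq (p.1 0) (fun _ => p.2)))
      (hA.comp ((hm0.comp measurable_fst).prodMk measurable_snd))
    simp only [trunc_zero, zero_add, consSeq_const_eq_trunc] at e3
    rw [e1, e2, e3, ← h0, lintegral_map (Measurable.lintegral_kernel_prod_right' (κ := R)
        (f := fun p : Z × Z => F (consSeq p.1 (fun _ => p.2))) hA) hm0]
  | succ n ih =>
    have hA : Measurable fun q : ((ℕ → Z) × Z) × Z => F (consSeq q.2 (extSeq n q.1.1 q.1.2)) :=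
      hF.comp (Measurable.consSeq measurable_snd (Measurable.extSeq n
        (measurable_snd.comp measurable_fst) (measurable_fst.comp measurable_fst)))
    have e1 := hν n (fun p => ∫⁻ w, F (consSeq w (extSeq n p.1 p.2)) ∂(Q (p.1 0)))
      (Measurable.lintegral_kernel_prod_right'
        (κ := Q.comap (fun p : (ℕ → Z) × Z => p.1 0) (hm0.comp measurable_fst)) hA)
    simp only [extSeq_trunc, trunc_zero] at e1
    have hH : Measurable fun q : (ℕ → Z) × Z => F (consSeq (q.1 0) (extSeq n (tailSeq q.1) q.2)) :=
      hF.comp (Measurable.consSeq (hm0.comp measurable_fst) (Measurable.extSeq n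
        measurable_snd (measurable_tailSeq.comp measurable_fst)))
    have e2 := ih (F := fun x => ∫⁻ v, F (consSeq (x 0) (extSeq n (tailSeq x) v)) ∂(R (x (n + 1))))
      (Measurable.lintegral_kernel_prod_right'
        (κ := R.comap (fun x : ℕ → Z => x (n + 1)) (measurable_pi_apply _)) hH)
    simp only [tailSeq_consSeq, trunc_self, trunc_zero] at e2
    have e3 := hν (n + 1) (fun q => F (consSeq (q.1 0) (extSeq n (tailSeq q.1) q.2))) hH
    simp only [trunc_zero, consSeq_extSeq_tailSeq_trunc] at e3
    rw [e1, e3, ← e2]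
    refine lintegral_congr fun y => ?_
    -- Given the path up to time `n`, the prepended point and the next point are drawn
    -- independently, so the two integrals commute.
    rw [lintegral_lintegral_swap]
    · refine lintegral_congr fun w => ?_
      simp [consSeq, trunc_self]
    · exact (hA.comp ((measurable_const.prodMk measurable_fst).prodMk
        measurable_snd)).aemeasurable

/-- Finitely many coordinates determine a law on paths, so the identity extends to functions of the
whole path, such as the limit of the backward iterates. -/
theorem IsMarkovLaw.lintegral_consSeq (hν : IsMarkovLaw R ν) (h0 : ν.map (fun y => y 0) = π)
    (hR : π ⊗ₘ R = (π ⊗ₘ Q).map Prod.swap) {F : (ℕ → Z) → ℝ≥0∞} (hF : Measurable F) :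
    ∫⁻ y, ∫⁻ w, F (consSeq w y) ∂(Q (y 0)) ∂ν = ∫⁻ y, F y ∂ν := by
  have hm0 : Measurable fun y : ℕ → Z => y 0 := measurable_pi_apply 0
  have hcons : Measurable fun p : (ℕ → Z) × Z => consSeq p.2 p.1 :=
    Measurable.consSeq measurable_snd measurable_fst
  set M : Measure (ℕ → Z) := (ν ⊗ₘ (Q.comap (fun y : ℕ → Z => y 0) hm0)).map
    (fun p => consSeq p.2 p.1) with hM
  have hMint : ∀ {F : (ℕ → Z) → ℝ≥0∞}, Measurable F →
      ∫⁻ y, F y ∂M = ∫⁻ y, ∫⁻ w, F (consSeq w y) ∂(Q (y 0)) ∂ν := fun {F} hF => by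
    rw [hM, lintegral_map hF hcons]
    exact Measure.lintegral_compProd (hF.comp hcons)
  have hMp : IsProbabilityMeasure M := Measure.isProbabilityMeasure_map hcons.aemeasurable
  have : M = ν := by
    refine measure_ext_of_map_trunc fun n => Measure.ext_of_lintegral _ fun f hf => ?_
    rw [lintegral_map hf (measurable_trunc _), lintegral_map hf (measurable_trunc _)]
    refine (hMint (hf.comp (measurable_trunc _))).trans ?_
    simp only [Function.comp_apply, trunc_succ_consSeq]
    exact hν.lintegral_consSeq_trunc h0 hR n hf
  rw [← hMint hF, this]

end Paths

/-! ### The time-reversed stationary chain -/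

section ReversedChain

variable {Z : Type*} [MeasurableSpace Z]

/-- The law of the Markov chain with kernel `R` and initial law `π`. -/
noncomputable def pathLaw (π : Measure Z) (R : Kernel Z Z) [IsMarkovKernel R] :
    Measure (ℕ → Z) :=
  Kernel.trajMeasure (X := fun _ => Z) π
    (fun n => R.comap (fun x : (i : Finset.Iic n) → Z => x ⟨n, by simp⟩) (measurable_pi_apply _))

variable {π : Measure Z} [IsProbabilityMeasure π] {R : Kernel Z Z} [IsMarkovKernel R]

instance : IsProbabilityMeasure (pathLaw π R) := by unfold pathLaw; infer_instance

theorem isMarkovLaw_pathLaw : IsMarkovLaw R (pathLaw π R) := by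
  intro n G hG
  set κ : (n : ℕ) → Kernel ((i : Finset.Iic n) → Z) Z := fun n =>
    R.comap (fun x : (i : Finset.Iic n) → Z => x ⟨n, by simp⟩) (measurable_pi_apply _) with hκ
  have h := Kernel.map_frestrictLe_trajMeasure_compProd_eq_map_trajMeasure
    (X := fun _ => Z) (μ₀ := π) (κ := κ) (a := n)
  let e : ((i : Finset.Iic n) → Z) → ℕ → Z := fun x i => x ⟨min i n, by simp⟩
  have he : Measurable e := measurable_pi_iff.2 fun _ => measurable_pi_apply _
  have hGe : Measurable fun q : ((i : Finset.Iic n) → Z) × Z => G (e q.1, q.2) :=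
    hG.comp ((he.comp measurable_fst).prodMk measurable_snd)
  have h2 := congrArg (fun m => ∫⁻ q, G (e q.1, q.2) ∂m) h
  rw [Measure.lintegral_compProd hGe, lintegral_map hGe (by fun_prop), lintegral_map
    (Measurable.lintegral_kernel_prod_right' (κ := κ n) hGe) (by fun_prop)] at h2
  exact h2.symm

theorem map_zero_pathLaw : (pathLaw π R).map (fun y => y 0) = π := by
  have h0 : (fun y : ℕ → Z => y 0) =
      (fun x : (i : Finset.Iic 0) → Z => x ⟨0, by simp⟩) ∘ Preorder.frestrictLe 0 := rfl
  rw [h0, ← Measure.map_map (measurable_pi_apply _) (by fun_prop), pathLaw, Kernel.trajMeasure,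
    Measure.map_comp _ _ (by fun_prop), Kernel.traj_map_frestrictLe, Kernel.partialTraj_self,
    Measure.id_comp, Measure.map_map (measurable_pi_apply _) (MeasurableEquiv.measurable _)]
  exact Measure.map_id

/-- The reversal is the posterior of `Q` with prior `π`, that is, the conditional law of `Z_0` given
`Z_1`. By invariance `Z_1` also has law `π`, so the disintegration is again over `π`. -/
theorem exists_reversed [StandardBorelSpace Z] {Q : Kernel Z Z} [IsMarkovKernel Q]
    (hπ : Q.Invariant π) :
    ∃ R : Kernel Z Z, IsMarkovKernel R ∧ π ⊗ₘ R = (π ⊗ₘ Q).map Prod.swap := by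
  have : Nonempty Z := nonempty_of_isProbabilityMeasure π
  refine ⟨posterior Q π, inferInstance, ?_⟩
  have h := compProd_posterior_eq_map_swap (κ := Q) (μ := π)
  rwa [hπ.def] at h

end ReversedChain

/-! ### Backward iteration and existence of an invariant law -/

section Backward

variable {Z : Type*} [MeasurableSpace Z] {E : Type*} [NormedAddCommGroup E] [NormedSpace ℝ E]
  [MeasurableSpace E]

/-- The backward iterates `st (y₀, st (y₁, … st (yₙ₋₁, 0)))`. -/
def backward (st : Z × E → E) : ℕ → (ℕ → Z) → E
  | 0, _ => 0
  | n + 1, y => st (y 0, backward st n (tailSeq y))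

/-- The limit of the backward iterates. -/
noncomputable def backwardLim (st : Z × E → E) (y : ℕ → Z) : E :=
  limUnder atTop (fun n => backward st n y)

variable {st : Z × E → E} {N : Seminorm ℝ E} {β r : ℝ}

theorem measurable_backward (hst : Measurable st) (n : ℕ) : Measurable (backward st n) := by
  induction n with
  | zero => exact measurable_const
  | succ n ih => exact hst.comp ((measurable_pi_apply 0).prodMk (ih.comp measurable_tailSeq))

/-- Consecutive iterates share their `n` outer maps and differ only in the innermost point, `0`
against `st (yₙ, 0)`, which are at distance at most `(1 - β) * r`. -/
theorem IsContractive.backward_sub_le (hc : IsContractive st N β r) (n : ℕ) (y : ℕ → Z) :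
    N (backward st (n + 1) y - backward st n y) ≤ r * β ^ n := by
  induction n generalizing y with
  | zero =>
    have h1 := hc.bound (y 0)
    have h2 := mul_nonneg hc.beta_nonneg hc.radius_nonneg
    simp only [backward, sub_zero, pow_zero, mul_one]
    linarith
  | succ n ih =>
    have := mul_le_mul_of_nonneg_left (ih (tailSeq y)) hc.beta_nonneg
    rw [pow_succ]
    refine (hc.contract (y 0) _ _).trans (this.trans (le_of_eq ?_))
    ring

variable [CompleteSpace E]

theorem IsContractive.tendsto_backward (hc : IsContractive st N β r) (y : ℕ → Z) :
    Tendsto (fun n => backward st n y) atTop (𝓝 (backwardLim st y)) := by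
  obtain ⟨c, hcN⟩ := hc.exists_norm_le
  refine CauchySeq.tendsto_limUnder
    (cauchySeq_of_le_geometric β (|c| * r) hc.beta_lt_one fun n => ?_)
  rw [dist_comm, dist_eq_norm, mul_assoc]
  refine (hcN _).trans ?_
  calc _ ≤ |c| * N (backward st (n + 1) y - backward st n y) :=
        mul_le_mul_of_nonneg_right (le_abs_self c) (apply_nonneg _ _)
    _ ≤ _ := mul_le_mul_of_nonneg_left (hc.backward_sub_le n y) (abs_nonneg c)

theorem IsContractive.continuous_apply (hc : IsContractive st N β r) (z : Z) :
    Continuous fun u => st (z, u) := by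
  obtain ⟨c, hcN⟩ := hc.exists_norm_le
  refine continuous_iff_continuousAt.2 fun u => ?_
  rw [ContinuousAt, tendsto_iff_norm_sub_tendsto_zero]
  have h : Tendsto (fun v => |c| * (β * N (v - u))) (𝓝 u) (𝓝 (|c| * (β * N (u - u)))) :=
    ((hc.cont.tendsto _).comp ((continuous_id.sub continuous_const).tendsto u)).const_mul β
      |>.const_mul |c|
  rw [sub_self, map_zero, mul_zero, mul_zero] at h
  refine squeeze_zero (fun _ => norm_nonneg _) (fun v => (hcN _).trans ?_) h
  calc _ ≤ |c| * N (st (z, v) - st (z, u)) :=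
        mul_le_mul_of_nonneg_right (le_abs_self c) (apply_nonneg _ _)
    _ ≤ _ := mul_le_mul_of_nonneg_left (hc.contract z v u) (abs_nonneg c)

theorem IsContractive.backwardLim_eq (hc : IsContractive st N β r) (y : ℕ → Z) :
    backwardLim st y = st (y 0, backwardLim st (tailSeq y)) :=
  tendsto_nhds_unique ((tendsto_add_atTop_iff_nat 1).2 (hc.tendsto_backward y))
    (((hc.continuous_apply (y 0)).tendsto _).comp (hc.tendsto_backward (tailSeq y)))

theorem IsContractive.measurable_backwardLim [BorelSpace E] (hc : IsContractive st N β r)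
    (hst : Measurable st) : Measurable (backwardLim st) :=
  measurable_of_tendsto_metrizable (measurable_backward hst)
    (tendsto_pi_nhds.2 hc.tendsto_backward)

/-- Let `y` be the reversed stationary chain, read as the present followed by the past, and let the
fibre be the composition of all fibre maps along the past `tailSeq y`. A step of the skew kernel
draws `w` from `Q(y₀, ·)` and moves the fibre to `st (y₀, backwardLim (tailSeq y)) = backwardLim y`:
this is the same construction applied to `consSeq w y`, which has the law of `y`. No continuity of
`Q` is required. -/
theorem exists_invariant [BorelSpace E] [StandardBorelSpace Z] {Q : Kernel Z Z} [IsMarkovKernel Q]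
    {hst : Measurable st} (hc : IsContractive st N β r) {π : Measure Z} [IsProbabilityMeasure π]
    (hπ : Q.Invariant π) :
    ∃ Pi : Measure (Z × E), IsProbabilityMeasure Pi ∧ (skewKernel Q st hst).Invariant Pi := by
  obtain ⟨R, hRm, hR⟩ := exists_reversed hπ
  have hΦ := hc.measurable_backwardLim hst
  have hg : Measurable fun y : ℕ → Z => (y 0, backwardLim st (tailSeq y)) :=
    (measurable_pi_apply 0).prodMk (hΦ.comp measurable_tailSeq)
  refine ⟨(pathLaw π R).map fun y => (y 0, backwardLim st (tailSeq y)),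
    Measure.isProbabilityMeasure_map hg.aemeasurable, ?_⟩
  refine Measure.ext_of_lintegral _ fun f hf => ?_
  rw [Measure.lintegral_bind (Kernel.aemeasurable _) hf.aemeasurable,
    lintegral_map (Measurable.lintegral_kernel hf) hg, lintegral_map hf hg]
  refine Eq.trans (lintegral_congr fun y => ?_)
    (isMarkovLaw_pathLaw.lintegral_consSeq map_zero_pathLaw hR (hf.comp hg))
  rw [skewKernel_apply, lintegral_map hf (by fun_prop), ← hc.backwardLim_eq]
  rfl

end Backward

/-! ### The Lyapunov norm and the step size condition -/

section Lyapunov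

variable {d : ℕ} {Abar S : Mat d}

theorem IsLyapunovSolution.inner_comm (hS : IsLyapunovSolution Abar S) (x y : Vec d) :
    inner ℝ (S x) y = inner ℝ (S y) x := by
  rw [← ContinuousLinearMap.adjoint_inner_right, hS.symm.adjoint_eq, real_inner_comm]

theorem IsLyapunovSolution.inner_self_nonneg (hS : IsLyapunovSolution Abar S) (x : Vec d) :
    0 ≤ inner ℝ (S x) x := by
  by_cases hx : x = 0
  · simp [hx]
  · exact (hS.pos x hx).le

theorem IsLyapunovSolution.inner_sq_le (hS : IsLyapunovSolution Abar S) (x y : Vec d) :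
    inner ℝ (S x) y ^ 2 ≤ inner ℝ (S x) x * inner ℝ (S y) y := by
  by_cases hy : y = 0
  · simp [hy]
  have hy' := hS.pos y hy
  set b := inner ℝ (S x) y
  set q := inner ℝ (S y) y
  -- Up to the factor `q`, this vector is the part of `x` that is `S`-orthogonal to `y`.
  have h := hS.inner_self_nonneg (q • x - b • y)
  have e : inner ℝ (S (q • x - b • y)) (q • x - b • y) =
      q * (inner ℝ (S x) x * q - b ^ 2) := by
    simp only [map_sub, map_smul, inner_sub_left, inner_sub_right, real_inner_smul_left,
      real_inner_smul_right]
    rw [hS.inner_comm y x]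
    ring
  rw [e] at h
  linarith [nonneg_of_mul_nonneg_right h hy']

theorem IsLyapunovSolution.wNorm_add_le (hS : IsLyapunovSolution Abar S) (x y : Vec d) :
    wNorm S (x + y) ≤ wNorm S x + wNorm S y := by
  unfold wNorm
  refine Real.sqrt_le_iff.2 ⟨by positivity, ?_⟩
  have h1 : inner ℝ (S x) y ≤ √(inner ℝ (S x) x) * √(inner ℝ (S y) y) := by
    rw [← Real.sqrt_mul (hS.inner_self_nonneg x)]
    exact Real.le_sqrt_of_sq_le (hS.inner_sq_le x y)
  rw [add_sq, Real.sq_sqrt (hS.inner_self_nonneg x), Real.sq_sqrt (hS.inner_self_nonneg y),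
    map_add, inner_add_left, inner_add_right, inner_add_right, hS.inner_comm y x]
  linarith

theorem wNorm_smul (c : ℝ) (x : Vec d) : wNorm S (c • x) = ‖c‖ * wNorm S x := by
  unfold wNorm
  rw [map_smul, real_inner_smul_left, real_inner_smul_right, ← mul_assoc,
    Real.sqrt_mul (mul_self_nonneg c), Real.sqrt_mul_self_eq_abs, Real.norm_eq_abs]

/-- `‖·‖_S` as a seminorm. -/
noncomputable def IsLyapunovSolution.wSeminorm (hS : IsLyapunovSolution Abar S) :
    Seminorm ℝ (Vec d) :=
  Seminorm.of (wNorm S) hS.wNorm_add_le wNorm_smul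

theorem wNorm_le (S : Mat d) (x : Vec d) : wNorm S x ≤ √‖S‖ * ‖x‖ := by
  unfold wNorm
  refine Real.sqrt_le_iff.2 ⟨by positivity, ?_⟩
  rw [mul_pow, Real.sq_sqrt (norm_nonneg S), sq, ← mul_assoc]
  exact (real_inner_le_norm _ _).trans (mul_le_mul_of_nonneg_right (S.le_opNorm x) (norm_nonneg x))

theorem IsLyapunovSolution.norm_pos (hS : IsLyapunovSolution Abar S) (hd : 1 ≤ d) : 0 < ‖S‖ := by
  have : Nonempty (Fin d) := ⟨⟨0, hd⟩⟩
  refine norm_pos_iff.2 fun h => ?_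
  obtain ⟨x, hx⟩ := exists_ne (0 : Vec d)
  simpa [h] using hS.pos x hx

theorem IsLyapunovSolution.rateA_pos (hS : IsLyapunovSolution Abar S) (hd : 1 ≤ d) :
    0 < rateA S := by
  have := hS.norm_pos hd
  unfold rateA; positivity

/-- Norms in the Lyapunov equation give `1 ≤ 2 ‖S‖ ‖Abar‖`. It follows that `a ≤ C_A`, and in
particular `C_A > 0`. -/
theorem IsLyapunovSolution.rateA_le (hS : IsLyapunovSolution Abar S) (hd : 1 ≤ d) :
    rateA S ≤ ‖Abar‖ := by
  have hn := hS.norm_pos hd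
  have : Nonempty (Fin d) := ⟨⟨0, hd⟩⟩
  have h1 : (1 : ℝ) ≤ 2 * ‖S‖ * ‖Abar‖ := by
    calc (1 : ℝ) = ‖(1 : Mat d)‖ := norm_one.symm
      _ = ‖ContinuousLinearMap.adjoint Abar * S + S * Abar‖ := by rw [hS.eqn]
      _ ≤ ‖ContinuousLinearMap.adjoint Abar‖ * ‖S‖ + ‖S‖ * ‖Abar‖ :=
        (norm_add_le _ _).trans (add_le_add (norm_mul_le _ _) (norm_mul_le _ _))
      _ = _ := by rw [LinearIsometryEquiv.norm_map]; ring
  unfold rateA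
  rw [div_le_iff₀ two_pos, inv_le_iff_one_le_mul₀ hn]
  linarith

/-- The Lyapunov equation says exactly that the term linear in `α` is `-α ‖x‖²`. -/
theorem IsLyapunovSolution.inner_step (hS : IsLyapunovSolution Abar S) (α : ℝ) (x : Vec d) :
    inner ℝ (S ((1 - α • Abar) x)) ((1 - α • Abar) x) =
      inner ℝ (S x) x - α * ‖x‖ ^ 2 + α ^ 2 * inner ℝ (S (Abar x)) (Abar x) := by
  have h1 : inner ℝ (S x) (Abar x) + inner ℝ (S (Abar x)) x = ‖x‖ ^ 2 := by
    rw [← real_inner_self_eq_norm_sq]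
    conv_rhs => rw [show inner ℝ x x = inner ℝ ((1 : Mat d) x) x from rfl, ← hS.eqn]
    change _ = inner ℝ (ContinuousLinearMap.adjoint Abar (S x) + S (Abar x)) x
    rw [inner_add_left, ContinuousLinearMap.adjoint_inner_left]
  rw [← h1]
  simp only [sub_apply, one_apply_eq_self, smul_apply, map_sub, map_smul, inner_sub_left, inner_sub_right,
    real_inner_smul_left, real_inner_smul_right]
  ring

/-- Since `a = 1 / (2 ‖S‖)`, the hypothesis gives `α ‖S‖ C_A² ≤ 1/16`: the quadratic term consumes
at most a sixteenth of the linear decrease. -/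
theorem IsLyapunovSolution.inner_step_le (hS : IsLyapunovSolution Abar S) (hd : 1 ≤ d) {α CA : ℝ}
    (hα : 0 < α) (hCA : ‖Abar‖ ≤ CA) (h : α * CA ^ 2 ≤ rateA S / 8) (x : Vec d) :
    inner ℝ (S ((1 - α • Abar) x)) ((1 - α • Abar) x) ≤ inner ℝ (S x) x - α / 2 * ‖x‖ ^ 2 := by
  have hn := hS.norm_pos hd
  rw [hS.inner_step]
  have h1 : inner ℝ (S (Abar x)) (Abar x) ≤ ‖S‖ * (CA ^ 2 * ‖x‖ ^ 2) := by
    have h2 : ‖Abar x‖ ≤ CA * ‖x‖ :=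
      (Abar.le_opNorm x).trans (mul_le_mul_of_nonneg_right hCA (norm_nonneg x))
    calc _ ≤ ‖S (Abar x)‖ * ‖Abar x‖ := real_inner_le_norm _ _
      _ ≤ ‖S‖ * ‖Abar x‖ * ‖Abar x‖ := by gcongr; exact S.le_opNorm _
      _ ≤ ‖S‖ * (CA * ‖x‖) * (CA * ‖x‖) := by
        have := (norm_nonneg _).trans h2
        gcongr
      _ = _ := by ring
  have h3 : ‖S‖ * (α * CA ^ 2) ≤ 1 / 16 := by
    calc _ ≤ ‖S‖ * (rateA S / 8) := by gcongr
      _ = 1 / 16 := by unfold rateA; field_simp; norm_num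
  have h4 : α ^ 2 * inner ℝ (S (Abar x)) (Abar x) ≤ α * ‖x‖ ^ 2 * (1 / 16) := by
    calc _ ≤ α ^ 2 * (‖S‖ * (CA ^ 2 * ‖x‖ ^ 2)) := by gcongr
      _ = α * ‖x‖ ^ 2 * (‖S‖ * (α * CA ^ 2)) := by ring
      _ ≤ _ := by gcongr
  have : 0 ≤ α * ‖x‖ ^ 2 := by positivity
  linarith

/-- The left side of `inner_step_le` is nonnegative, which bounds `‖x‖` without the eigenvalues of
`S`. The constant blows up as `α → 0`, but it only serves qualitative statements and does not enter
the final bound. -/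
theorem IsLyapunovSolution.norm_le_wNorm (hS : IsLyapunovSolution Abar S) (hd : 1 ≤ d) {α CA : ℝ}
    (hα : 0 < α) (hCA : ‖Abar‖ ≤ CA) (h : α * CA ^ 2 ≤ rateA S / 8) (x : Vec d) :
    ‖x‖ ≤ √(2 / α) * wNorm S x := by
  unfold wNorm
  rw [← Real.sqrt_mul (by positivity)]
  refine Real.le_sqrt_of_sq_le ?_
  have h1 := (hS.inner_self_nonneg _).trans (hS.inner_step_le hd hα hCA h x)
  rw [div_mul_eq_mul_div, le_div_iff₀ hα]
  linarith

/-- As `‖x‖_S² ≤ ‖S‖ ‖x‖²` and `a = 1 / (2 ‖S‖)`, the decrease `α/2 ‖x‖²` is at least `α a ‖x‖_S²`.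
-/
theorem IsLyapunovSolution.wNorm_step_le (hS : IsLyapunovSolution Abar S) (hd : 1 ≤ d) {α CA : ℝ}
    (hα : 0 < α) (hCA : ‖Abar‖ ≤ CA) (h : α * CA ^ 2 ≤ rateA S / 8) (x : Vec d) :
    wNorm S ((1 - α • Abar) x) ≤ √(1 - α * rateA S) * wNorm S x := by
  have hn := hS.norm_pos hd
  have key : inner ℝ (S ((1 - α • Abar) x)) ((1 - α • Abar) x) ≤
      (1 - α * rateA S) * inner ℝ (S x) x := by
    have h1 := hS.inner_step_le hd hα hCA h x
    have h2 : rateA S * inner ℝ (S x) x ≤ ‖x‖ ^ 2 / 2 := by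
      have h3 : inner ℝ (S x) x ≤ ‖S‖ * ‖x‖ ^ 2 := by
        rw [sq, ← mul_assoc]
        exact (real_inner_le_norm _ _).trans
          (mul_le_mul_of_nonneg_right (S.le_opNorm x) (norm_nonneg x))
      calc _ ≤ rateA S * (‖S‖ * ‖x‖ ^ 2) :=
            mul_le_mul_of_nonneg_left h3 (hS.rateA_pos hd).le
        _ = _ := by unfold rateA; field_simp
    nlinarith
  unfold wNorm
  rw [← Real.sqrt_mul' _ (hS.inner_self_nonneg x)]
  exact Real.sqrt_le_sqrt key

/-- The spectrum of `S` is finite, nonempty and positive, so `lamMin S` is an attained positive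
eigenvalue and lies below `lamMax S`. -/
theorem IsLyapunovSolution.one_le_kappa (hS : IsLyapunovSolution Abar S) (hd : 1 ≤ d) :
    1 ≤ kappa S := by
  have : Nonempty (Fin d) := ⟨⟨0, hd⟩⟩
  set Λ := {μ : ℝ | Module.End.HasEigenvalue (S : Vec d →ₗ[ℝ] Vec d) μ} with hΛ
  have hfin : Λ.Finite := Module.End.finite_hasEigenvalue (S : Vec d →ₗ[ℝ] Vec d)
  have hsymm : (S : Vec d →ₗ[ℝ] Vec d).IsSymmetric := fun x y => by
    have := hS.inner_comm x y
    rw [real_inner_comm x] at this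
    exact this
  have hne : Λ.Nonempty := ⟨_, hsymm.hasEigenvalue_iSup_of_finiteDimensional⟩
  have hpos : ∀ μ ∈ Λ, 0 < μ := by
    intro μ hμ
    obtain ⟨v, hv⟩ := Module.End.HasEigenvalue.exists_hasEigenvector hμ
    have h1 : S v = μ • v := hv.apply_eq_smul
    have h2 := hS.pos v hv.2
    rw [h1, real_inner_smul_left, real_inner_self_eq_norm_sq] at h2
    exact pos_of_mul_pos_left h2 (by positivity)
  have hmin : lamMin S ∈ Λ := hne.csInf_mem hfin
  have hle : lamMin S ≤ lamMax S := le_csSup hfin.bddAbove hmin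
  exact (one_le_div (hpos _ hmin)).2 hle

/-- Consequences of the step size condition. -/
theorem IsLyapunovSolution.stepSize_bounds (hS : IsLyapunovSolution Abar S) (hd : 1 ≤ d)
    {α CA : ℝ} (hα : 0 < α) (hCA : ‖Abar‖ ≤ CA) {t : ℕ} (ht : 1 ≤ t)
    (hlt : α < alphaB Abar S CA t 1) :
    α * CA * t ≤ 1 / 8 ∧ α ≤ 1 ∧ α * CA ^ 2 ≤ rateA S / 8 := by
  have ha := hS.rateA_pos hd
  have haC : rateA S ≤ CA := (hS.rateA_le hd).trans hCA
  have hC : 0 < CA := ha.trans_le haC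
  have hκ : 1 ≤ √(kappa S) := Real.one_le_sqrt.2 (hS.one_le_kappa hd)
  have ht' : (1 : ℝ) ≤ t := by exact_mod_cast ht
  have ht0 : (0 : ℝ) < t := by linarith
  have h1 : α * t < min (alphaM Abar S CA (1 * (1 + Real.log d)))
      (min (1 / (1 + CA)) (1 / (rateA S * 1))) := by
    rw [← lt_mul_inv_iff₀ ht0]; exact hlt
  obtain ⟨h2, h3⟩ := lt_min_iff.1 h1
  have h4 : α * t < alphaInfM Abar S CA := h2.trans_le (min_le_left _ _)
  have h5 : α * t < 1 / (1 + CA) := h3.trans_le (min_le_left _ _)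
  have hm : 8 * √(kappa S) * CA / rateA S ≤ (blockLen S CA : ℝ) := Nat.le_ceil _
  have hm' : (blockLen S CA : ℝ)⁻¹ ≤ (8 * √(kappa S) * CA / rateA S)⁻¹ :=
    inv_anti₀ (by positivity) hm
  -- Of the minimum only `κ^{-1/2} C_A⁻¹` is kept. With `m⁻¹ ≤ a / (8 κ^{1/2} C_A)` and `κ ≥ 1` this
  -- leaves `a / (8 C_A²)`.
  have h6 : alphaInfM Abar S CA ≤ (CA⁻¹) * (rateA S / (8 * CA)) := by
    unfold alphaInfM
    calc _ ≤ ((√(kappa S))⁻¹ * CA⁻¹) * (blockLen S CA : ℝ)⁻¹ := by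
          gcongr
          exact (min_le_right _ _).trans (min_le_left _ _)
      _ ≤ (1 * CA⁻¹) * (rateA S / (8 * CA)) := by
          gcongr
          · exact inv_le_one_of_one_le₀ hκ
          · refine hm'.trans ?_
            rw [inv_div]
            gcongr
            nlinarith
      _ = _ := by rw [one_mul]
  have h7 : α * t * CA ^ 2 ≤ rateA S / 8 := by
    calc _ ≤ ((CA⁻¹) * (rateA S / (8 * CA))) * CA ^ 2 := by exact mul_le_mul_of_nonneg_right (h4.le.trans h6) (sq_nonneg CA)
      _ = _ := by field_simp
  have hαt : α ≤ α * t := le_mul_of_one_le_right hα.le ht'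
  refine ⟨?_, ?_, ?_⟩
  -- Here `a ≤ C_A` is used: `α t C_A² ≤ a/8 ≤ C_A/8`, and one factor `C_A` cancels.
  · have : α * t * CA * CA ≤ 1 / 8 * CA := by nlinarith
    have := le_of_mul_le_mul_right this hC
    linarith
  · refine (hαt.trans h5.le).trans ?_
    rw [div_le_one (by linarith)]; linarith
  · refine le_trans ?_ h7
    gcongr

end Lyapunov

/-! ### Uniform contraction of the triangular recursion -/

section Contraction

variable {d : ℕ}

/-- The seminorm `p(u₂) + c p(u₁) + c² p(u₀)`. -/
noncomputable def stackedSeminorm (p : Seminorm ℝ (Vec d)) (c : NNReal) :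
    Seminorm ℝ (Vec d × Vec d × Vec d) :=
  p.comp (LinearMap.snd ℝ (Vec d) (Vec d) ∘ₗ LinearMap.snd ℝ (Vec d) (Vec d × Vec d)) +
    (c • p.comp (LinearMap.fst ℝ (Vec d) (Vec d) ∘ₗ LinearMap.snd ℝ (Vec d) (Vec d × Vec d)) +
      c ^ 2 • p.comp (LinearMap.fst ℝ (Vec d) (Vec d × Vec d)))

theorem stackedSeminorm_apply (p : Seminorm ℝ (Vec d)) (c : NNReal) (u : Vec d × Vec d × Vec d) :
    stackedSeminorm p c u = p u.2.2 + ((c : ℝ) * p u.2.1 + (c : ℝ) ^ 2 * p u.1) := rfl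

/-- The step is block triangular: the diagonal blocks contract by `β`, and the off-diagonal blocks
have `p`-norm at most `α * K'`. With weights `1, w, w²` on `j₂, j₁, j₀` each off-diagonal term is
charged to the next heavier component, where a large `w` makes it cost at most `(1 - β) / 2`. -/
theorem exists_isContractive_stepJ {Z : Type*} {α : ℝ} (hα : 0 ≤ α) {Abar : Mat d} {At : Z → Mat d}
    {e : Z → Vec d} {p : Seminorm ℝ (Vec d)} {c M β K Ce : ℝ} (hK : 0 ≤ K) (hCe : 0 ≤ Ce)
    (hc : 0 ≤ c) (hM : 0 ≤ M) (hpc : ∀ x, ‖x‖ ≤ c * p x) (hpM : ∀ x, p x ≤ M * ‖x‖)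
    (hβ0 : 0 ≤ β) (hβ1 : β < 1)
    (hB : ∀ x, p ((1 - α • Abar) x) ≤ β * p x) (hAt : ∀ z, ‖At z‖ ≤ K) (he : ∀ z, ‖e z‖ ≤ Ce) :
    ∃ (N : Seminorm ℝ (Vec d × Vec d × Vec d)) (β' r : ℝ),
      IsContractive (stepJ α Abar At e) N β' r := by
  set K' := M * K * c with hK'
  have hK'0 : 0 ≤ K' := by positivity
  have hAtp : ∀ z x, p (At z x) ≤ K' * p x := fun z x => by
    calc _ ≤ M * ‖At z x‖ := hpM _
      _ ≤ M * (K * (c * p x)) := by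
        gcongr
        exact ((At z).le_opNorm x).trans (mul_le_mul (hAt z) (hpc x) (norm_nonneg _) hK)
      _ = _ := by rw [hK']; ring
  have h1β : 0 < 1 - β := by linarith
  -- The first summand absorbs the off-diagonal blocks; the `1` gives `w ≥ 1`, so that the stacked
  -- seminorm dominates `p` of each component.
  obtain ⟨w, hw⟩ : ∃ w : NNReal, (w : ℝ) = 2 * α * K' / (1 - β) + 1 :=
    ⟨⟨2 * α * K' / (1 - β) + 1, by positivity⟩, rfl⟩
  have hw1 : 1 ≤ (w : ℝ) := by rw [hw]; linarith [show 0 ≤ 2 * α * K' / (1 - β) by positivity]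
  have hwK : α * K' ≤ (1 - β) / 2 * w := by
    rw [hw, mul_add, mul_one]
    have : (1 - β) / 2 * (2 * α * K' / (1 - β)) = α * K' := by field_simp
    linarith
  -- The image of the zero vector is `(-α ε(z), 0, 0)`, of seminorm at most `w² α M Ce`, and `1 - (1
  -- + β) / 2 = (1 - β) / 2`.
  set r : ℝ := w ^ 2 * (α * (M * Ce)) / ((1 - β) / 2) with hr
  refine ⟨stackedSeminorm p w, (1 + β) / 2, r, by linarith, by linarith, by positivity, ?_, ?_,
    ?_, c, ?_⟩
  · intro z u v
    set x := u - v with hx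
    have e0 : (stepJ α Abar At e (z, u) - stepJ α Abar At e (z, v)) =
        ((1 - α • Abar) x.1, (1 - α • Abar) x.2.1 - α • At z x.1,
          (1 - α • Abar) x.2.2 - α • At z x.2.1) := by
      simp only [stepJ, hx, Prod.fst_sub, Prod.snd_sub, map_sub, smul_sub, Prod.mk_sub_mk]
      refine Prod.ext ?_ (Prod.ext ?_ ?_) <;> simp only <;> abel
    rw [e0, stackedSeminorm_apply, stackedSeminorm_apply]
    have hsub : ∀ a b : Vec d, p ((1 - α • Abar) a - α • At z b) ≤ β * p a + (1 - β) / 2 * w * p b :=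
      fun a b => by
        refine (map_sub_le_add p _ _).trans (add_le_add (hB a) ?_)
        rw [map_smul_eq_mul, Real.norm_of_nonneg hα]
        calc _ ≤ α * (K' * p b) := mul_le_mul_of_nonneg_left (hAtp z b) hα
          _ = α * K' * p b := by ring
          _ ≤ _ := mul_le_mul_of_nonneg_right hwK (apply_nonneg _ _)
    have i1 := hsub x.2.2 x.2.1
    have i2 := mul_le_mul_of_nonneg_left (hsub x.2.1 x.1) w.coe_nonneg
    have i3 := mul_le_mul_of_nonneg_left (hB x.1) (sq_nonneg (w : ℝ))
    have j1 : 0 ≤ (1 - β) / 2 * p x.2.2 := mul_nonneg (by linarith) (apply_nonneg _ _)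
    simp only
    linarith
  · intro z
    have e0 : stepJ α Abar At e (z, 0) = (-(α • e z), 0, 0) := by simp [stepJ]
    rw [e0, stackedSeminorm_apply]
    simp only [map_zero, mul_zero, zero_add, map_neg_eq_map, map_smul_eq_mul,
      Real.norm_of_nonneg hα]
    have : (1 - (1 + β) / 2) * r = w ^ 2 * (α * (M * Ce)) := by
      rw [hr, show 1 - (1 + β) / 2 = (1 - β) / 2 by ring]
      field_simp
    rw [this]
    gcongr
    exact (hpM _).trans (mul_le_mul_of_nonneg_left (he z) hM)
  · have hp : Continuous p := Seminorm.continuous_of_le (q := M.toNNReal • normSeminorm ℝ (Vec d))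
      (by simpa using (continuous_norm.const_smul M.toNNReal)) (fun x => by
        simpa [NNReal.smul_def, Real.coe_toNNReal M hM] using hpM x)
    change Continuous fun u : Vec d × Vec d × Vec d =>
      p u.2.2 + ((w : ℝ) * p u.2.1 + (w : ℝ) ^ 2 * p u.1)
    fun_prop
  · intro u
    rw [stackedSeminorm_apply]
    have n0 := apply_nonneg p u.1
    have n1 := apply_nonneg p u.2.1
    have n2 := apply_nonneg p u.2.2
    have b1 : p u.2.1 ≤ w * p u.2.1 := le_mul_of_one_le_left n1 hw1
    have b0 : p u.1 ≤ (w : ℝ) ^ 2 * p u.1 := le_mul_of_one_le_left n0 (one_le_pow₀ hw1)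
    have key : ∀ x : Vec d, p x ≤ p u.2.2 + ((w : ℝ) * p u.2.1 + (w : ℝ) ^ 2 * p u.1) →
        ‖x‖ ≤ c * (p u.2.2 + ((w : ℝ) * p u.2.1 + (w : ℝ) ^ 2 * p u.1)) := fun x hx =>
      (hpc x).trans (mul_le_mul_of_nonneg_left hx hc)
    exact max_le (key _ (by linarith)) (max_le (key _ (by linarith)) (key _ (by linarith)))

theorem exists_norm_pow_le {B : Mat d} {p : Seminorm ℝ (Vec d)} {c M β : ℝ}
    (hc : 0 ≤ c) (hM : 0 ≤ M) (hpc : ∀ x, ‖x‖ ≤ c * p x) (hpM : ∀ x, p x ≤ M * ‖x‖) (hβ0 : 0 ≤ β)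
    (hB : ∀ x, p (B x) ≤ β * p x) (n : ℕ) : ‖B ^ n‖ ≤ c * M * β ^ n := by
  have h1 : ∀ x, p ((B ^ n) x) ≤ β ^ n * p x := by
    induction n with
    | zero => simp
    | succ n ih =>
      intro x
      rw [pow_succ', pow_succ', mul_assoc]
      exact (hB _).trans (mul_le_mul_of_nonneg_left (ih x) hβ0)
  refine ContinuousLinearMap.opNorm_le_bound _ (by positivity) fun x => ?_
  calc _ ≤ c * (β ^ n * (M * ‖x‖)) := (hpc _).trans
        (mul_le_mul_of_nonneg_left ((h1 x).trans (by gcongr; exact hpM x)) hc)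
    _ = _ := by ring

end Contraction

/-! ### Stationary correlations and their decay -/

section Correlation

variable {d : ℕ} {Z : Type*} [MeasurableSpace Z] {Q : Kernel Z Z} [IsMarkovKernel Q]
  {π : Measure Z} [IsProbabilityMeasure π] {At : Z → Mat d} {e : Z → Vec d} {CA Ce : ℝ}

theorem stronglyMeasurable_apply {α V W : Type*} [MeasurableSpace α] [NormedAddCommGroup V]
    [NormedSpace ℝ V] [NormedAddCommGroup W] [NormedSpace ℝ W] {G : α → V →L[ℝ] W} {v : α → V}
    (hG : StronglyMeasurable G) (hv : StronglyMeasurable v) :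
    StronglyMeasurable fun a => G a (v a) :=
  isBoundedBilinearMap_apply.continuous.comp_stronglyMeasurable (hG.prodMk hv)

theorem norm_apply_le_mul {V W : Type*} [NormedAddCommGroup V]
    [NormedSpace ℝ V] [NormedAddCommGroup W] [NormedSpace ℝ W] {G : V →L[ℝ] W} {v : V} {a b : ℝ}
    (hG : ‖G‖ ≤ a) (hv : ‖v‖ ≤ b) : ‖G v‖ ≤ a * b :=
  (G.le_opNorm v).trans (mul_le_mul hG hv (norm_nonneg v) ((norm_nonneg G).trans hG))

theorem norm_mul_le_mul {R : Type*} [NormedRing R] {x y : R} {a b : ℝ} (hx : ‖x‖ ≤ a)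
    (hy : ‖y‖ ≤ b) : ‖x * y‖ ≤ a * b :=
  (norm_mul_le x y).trans (mul_le_mul hx hy (norm_nonneg y) ((norm_nonneg x).trans hx))

theorem avg_mul_const {G : Z → Mat d} {C : ℝ} (hG : StronglyMeasurable G) (hC : ∀ z, ‖G z‖ ≤ C)
    (n : ℕ) (M : Mat d) : (avg Q n fun z => G z * M) = fun z => avg Q n G z * M := by
  funext z
  exact ((ContinuousLinearMap.compL ℝ (Vec d) (Vec d) (Vec d)).flip M).integral_comp_comm
    (integrable_of_norm_le hG hC)

theorem avg_sub {G H : Z → Mat d} {C D : ℝ} (hG : StronglyMeasurable G) (hC : ∀ z, ‖G z‖ ≤ C)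
    (hH : StronglyMeasurable H) (hD : ∀ z, ‖H z‖ ≤ D) (n : ℕ) (z : Z) :
    avg Q n (fun z => G z - H z) z = avg Q n G z - avg Q n H z :=
  integral_sub (integrable_of_norm_le hG hC) (integrable_of_norm_le hH hD)

/-- The function `y ↦ (Qᵏ⁺¹ Ã)(y) M Ã(y)`. -/
noncomputable def corrFun (Q : Kernel Z Z) (At : Z → Mat d) (M : Mat d) (k : ℕ) (y : Z) : Mat d :=
  avg Q (k + 1) At y * M * At y

/-- The stationary expectation of `Ã(Z_{k+i+2}) M Ã(Z_{i+1}) N ε(Z_0)`. -/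
noncomputable def corr (Q : Kernel Z Z) (π : Measure Z) (At : Z → Mat d) (e : Z → Vec d)
    (M N : Mat d) (k i : ℕ) : Vec d :=
  ∫ z, avg Q (i + 1) (corrFun Q At M k) z (N (e z)) ∂π

theorem stronglyMeasurable_corrFun (hAt : StronglyMeasurable At) (M : Mat d) (k : ℕ) :
    StronglyMeasurable (corrFun Q At M k) :=
  ((stronglyMeasurable_avg _ hAt).mul_const M).mul hAt

theorem norm_corrFun_le (hCA : ∀ z, ‖At z‖ ≤ CA) (M : Mat d) (k : ℕ) (y : Z) :
    ‖corrFun Q At M k y‖ ≤ CA * ‖M‖ * CA :=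
  norm_mul_le_mul (norm_mul_le_mul (norm_avg_le _ hCA y) le_rfl) (hCA y)

theorem norm_corrFun_le_of_mixing (hπ : Q.Invariant π) (hAt : StronglyMeasurable At)
    (hCA : ∀ z, ‖At z‖ ≤ CA) (hAt0 : ∫ z, At z ∂π = 0) (M : Mat d) {k : ℕ} {s : ℝ}
    (hs : dobrushin (Q ^ (k + 1)) ≤ s) (y : Z) :
    ‖corrFun Q At M k y‖ ≤ 2 * CA * s * ‖M‖ * CA := by
  refine norm_mul_le_mul (norm_mul_le_mul ?_ le_rfl) (hCA y)
  simpa [hAt0] using norm_avg_sub_integral_le hπ hs hAt hCA y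

theorem integrable_corr {H : Z → Mat d} {C : ℝ} (hH : StronglyMeasurable H) (hC : ∀ z, ‖H z‖ ≤ C)
    (he : StronglyMeasurable e) (hCe : ∀ z, ‖e z‖ ≤ Ce) (n : ℕ) (N : Mat d) :
    Integrable (fun z => avg Q n H z (N (e z))) π :=
  integrable_of_norm_le (stronglyMeasurable_apply (stronglyMeasurable_avg n hH)
    (N.continuous.comp_stronglyMeasurable he))
    (fun z => norm_apply_le_mul (norm_avg_le n hC z) (norm_apply_le_mul le_rfl (hCe z)))

/-- Both means are used: `∫ At dπ = 0` makes `Qᵏ⁺¹ At`, and with it `corrFun`, of size `s`; `∫ e dπ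
= 0` allows the mean `Hbar` of `corrFun` to be subtracted for free, which gains the factor `s'`. -/
theorem norm_corr_le (hπ : Q.Invariant π) (hAt : StronglyMeasurable At)
    (hCA : ∀ z, ‖At z‖ ≤ CA) (hAt0 : ∫ z, At z ∂π = 0) (he : StronglyMeasurable e)
    (hCe : ∀ z, ‖e z‖ ≤ Ce) (he0 : ∫ z, e z ∂π = 0) (M N : Mat d) {k i : ℕ} {s s' : ℝ}
    (hs : dobrushin (Q ^ (k + 1)) ≤ s) (hs' : dobrushin (Q ^ (i + 1)) ≤ s') :
    ‖corr Q π At e M N k i‖ ≤ 4 * CA ^ 2 * Ce * (s * s') * (‖M‖ * ‖N‖) := by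
  have hm := stronglyMeasurable_corrFun (Q := Q) hAt M k
  have hb := norm_corrFun_le_of_mixing hπ hAt hCA hAt0 M hs
  set Hbar := ∫ z, corrFun Q At M k z ∂π with hHbar
  have h0 : ∫ z, Hbar (N (e z)) ∂π = 0 := by
    have := (Hbar ∘L N).integral_comp_comm (integrable_of_norm_le (μ := π) he hCe)
    rw [he0, map_zero] at this
    exact this
  have h1 : corr Q π At e M N k i =
      ∫ z, (avg Q (i + 1) (corrFun Q At M k) z - Hbar) (N (e z)) ∂π := by
    simp only [sub_apply]
    rw [integral_sub (integrable_corr hm hb he hCe _ _), h0, sub_zero]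
    · rfl
    · exact integrable_of_norm_le
        ((Hbar ∘L N).continuous.comp_stronglyMeasurable he)
        (fun z => norm_apply_le_mul (G := Hbar ∘L N) le_rfl (hCe z))
  rw [h1]
  refine norm_integral_le_of_norm_le_prob (Eventually.of_forall fun z => ?_)
  refine (norm_apply_le_mul (norm_avg_sub_integral_le hπ hs' hm hb z)
    (norm_apply_le_mul le_rfl (hCe z))).trans (le_of_eq ?_)
  ring

theorem corr_sub_corr_one (hAt : StronglyMeasurable At) (hCA : ∀ z, ‖At z‖ ≤ CA)
    (he : StronglyMeasurable e) (hCe : ∀ z, ‖e z‖ ≤ Ce) (M N : Mat d) (k i : ℕ) :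
    corr Q π At e M N k i - corr Q π At e 1 1 k i =
      corr Q π At e (M - 1) N k i + corr Q π At e 1 (N - 1) k i := by
  have hm := fun M => stronglyMeasurable_corrFun (Q := Q) hAt M k
  have hb := fun M => norm_corrFun_le (Q := Q) hCA M k
  have hi := fun M N => integrable_corr (Q := Q) (π := π) (hm M) (hb M) he hCe (i + 1) N
  have h1 : ∀ z, avg Q (i + 1) (corrFun Q At (M - 1) k) z =
      avg Q (i + 1) (corrFun Q At M k) z - avg Q (i + 1) (corrFun Q At 1 k) z := fun z => by
    rw [← avg_sub (hm M) (hb M) (hm 1) (hb 1)]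
    congr 1
    funext y
    simp only [corrFun, mul_sub, sub_mul]
  unfold corr
  rw [← integral_sub (hi _ _) (hi _ _), ← integral_add (hi _ _) (hi _ _)]
  refine integral_congr_ae (Eventually.of_forall fun z => ?_)
  simp only [h1, sub_apply, map_sub, one_apply_eq_self]
  abel

theorem norm_one_add_pow_sub_one_le {R : Type*} [NormedRing R] [NormOneClass R] (a : R) (n : ℕ) :
    ‖(1 + a) ^ n - 1‖ ≤ (1 + ‖a‖) ^ n - 1 := by
  induction n with
  | zero => simp
  | succ n ih =>
    have h1 : ‖1 + a‖ ≤ 1 + ‖a‖ := (norm_add_le _ _).trans (by rw [norm_one])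
    have h2 : (1 + a) ^ (n + 1) - 1 = (1 + a) * ((1 + a) ^ n - 1) + a := by
      rw [pow_succ']; noncomm_ring
    rw [h2]
    refine (norm_add_le _ _).trans ((add_le_add (norm_mul_le_mul h1 ih) le_rfl).trans
      (le_of_eq ?_))
    ring

/-- Bilinearity splits the difference into `(M - 1, N)` and `(1, N - 1)`, and `((1+x)^k - 1)(1+x)^i
+ ((1+x)^i - 1)` collapses to `(1+x)^(k+i) - 1`. The powers are allowed to grow here; the mixing
rates compensate for this. -/
theorem norm_corr_pow_sub_corr_one_le [NeZero d] (hπ : Q.Invariant π) (hAt : StronglyMeasurable At)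
    (hCA : ∀ z, ‖At z‖ ≤ CA) (hAt0 : ∫ z, At z ∂π = 0) (he : StronglyMeasurable e)
    (hCe : ∀ z, ‖e z‖ ≤ Ce) (he0 : ∫ z, e z ∂π = 0) {a : Mat d} {x : ℝ} (ha : ‖a‖ ≤ x)
    {k i : ℕ} {s s' : ℝ} (hs : dobrushin (Q ^ (k + 1)) ≤ s) (hs' : dobrushin (Q ^ (i + 1)) ≤ s') :
    ‖corr Q π At e ((1 + a) ^ k) ((1 + a) ^ i) k i - corr Q π At e 1 1 k i‖ ≤
      4 * CA ^ 2 * Ce * (s * s') * ((1 + x) ^ (k + i) - 1) := by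
  have : Nonempty Z := nonempty_of_isProbabilityMeasure π
  have z₀ : Z := Classical.arbitrary Z
  have hdn : ∀ n, 0 ≤ dobrushin (Q ^ n) := fun n => Real.iSup_nonneg fun p => by
    unfold tvNorm; positivity
  have hs0 := (hdn _).trans hs
  have hs0' := (hdn _).trans hs'
  have hCe0 := (norm_nonneg _).trans (hCe z₀)
  have hpow : ∀ n, ‖(1 + a) ^ n - 1‖ ≤ (1 + x) ^ n - 1 := fun n =>
    (norm_one_add_pow_sub_one_le a n).trans (by gcongr)
  have hpow' : ∀ n, ‖(1 + a) ^ n‖ ≤ (1 + x) ^ n := fun n => by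
    have h := norm_add_le ((1 + a) ^ n - 1) 1
    rw [sub_add_cancel, norm_one] at h
    linarith [hpow n]
  rw [corr_sub_corr_one hAt hCA he hCe]
  refine (norm_add_le _ _).trans ((add_le_add
    (norm_corr_le hπ hAt hCA hAt0 he hCe he0 _ _ hs hs')
    (norm_corr_le hπ hAt hCA hAt0 he hCe he0 _ _ hs hs')).trans ?_)
  rw [← mul_add]
  refine mul_le_mul_of_nonneg_left ?_ (by positivity)
  rw [norm_one, one_mul]
  have h1 : (0 : ℝ) ≤ (1 + x) ^ k - 1 := (norm_nonneg _).trans (hpow k)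
  calc _ ≤ ((1 + x) ^ k - 1) * (1 + x) ^ i + ((1 + x) ^ i - 1) :=
        add_le_add (mul_le_mul (hpow k) (hpow' i) (norm_nonneg _) h1) (hpow i)
    _ = _ := by rw [pow_add]; ring

end Correlation

/-! ### Moment identities under the invariant law -/

section Moments

variable {d : ℕ} {Z : Type*} [MeasurableSpace Z] {Q : Kernel Z Z} [IsMarkovKernel Q]
  {π : Measure Z} [IsProbabilityMeasure π] {At : Z → Mat d} {e : Z → Vec d} {CA Ce : ℝ}
  {α β r : ℝ} {Abar : Mat d} {N : Seminorm ℝ (Vec d × Vec d × Vec d)}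
  {hst : Measurable (stepJ α Abar At e)} {Pi : Measure (Z × Vec d × Vec d × Vec d)}
  [IsProbabilityMeasure Pi]

/-- The constant sequence `Pi` is within `2 * C * s n` of the `π`-integral for every `n ≥ 1`; let
`n` tend to infinity. -/
theorem integral_fst_of_invariant {E F : Type*} [NormedAddCommGroup E] [NormedSpace ℝ E]
    [MeasurableSpace E] [BorelSpace E] [NormedAddCommGroup F] [NormedSpace ℝ F] [CompleteSpace F]
    {st : Z × E → E} {hst : Measurable st} {N : Seminorm ℝ E} (hc : IsContractive st N β r)
    {Pi : Measure (Z × E)} [IsProbabilityMeasure Pi] (hPi : (skewKernel Q st hst).Invariant Pi)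
    (hπ : Q.Invariant π) {s : ℕ → ℝ} (hs : ∀ n, 1 ≤ n → dobrushin (Q ^ n) ≤ s n)
    (hs0 : Tendsto s atTop (𝓝 0)) {g : Z → F} {C : ℝ} (hg : StronglyMeasurable g)
    (hC : ∀ z, ‖g z‖ ≤ C) : ∫ p, g p.1 ∂Pi = ∫ z, g z ∂π := by
  have h := isLawSeq_const hPi (ae_ball_of_invariant hc hPi)
  have hlim : Tendsto (fun n => 2 * C * s n) atTop (𝓝 (2 * C * 0)) := hs0.const_mul _
  rw [mul_zero] at hlim
  have h0 := ge_of_tendsto hlim (eventually_atTop.2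
    ⟨1, fun n hn => h.norm_integral_fst_sub_le hc hπ hg hC (hs n hn)⟩)
  exact sub_eq_zero.1 (norm_le_zero_iff.1 h0)

theorem integral_eq_integral_skewOp {E F : Type*} [NormedAddCommGroup E] [NormedSpace ℝ E]
    [MeasurableSpace E] [BorelSpace E] [NormedAddCommGroup F] [NormedSpace ℝ F]
    {st : Z × E → E} {hst : Measurable st} {N : Seminorm ℝ E} (hc : IsContractive st N β r)
    {Pi : Measure (Z × E)} [IsProbabilityMeasure Pi] (hPi : (skewKernel Q st hst).Invariant Pi)
    {f : Z × E → F} {C L : ℝ} (hf : IsTest N r f C L) :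
    ∫ p, f p ∂Pi = ∫ p, skewOp Q st f p ∂Pi := by
  rw [← integral_bind_skewKernel hc hst (ae_ball_of_invariant hc hPi) hf, hPi.def]

/-- The projections of `(j₀, j₁, j₂)`. -/
noncomputable def proj0 (d : ℕ) : (Vec d × Vec d × Vec d) →L[ℝ] Vec d :=
  ContinuousLinearMap.fst ℝ _ _

/-- The projection to `j₁`. -/
noncomputable def proj1 (d : ℕ) : (Vec d × Vec d × Vec d) →L[ℝ] Vec d :=
  ContinuousLinearMap.fst ℝ _ _ ∘L ContinuousLinearMap.snd ℝ _ _

/-- The projection to `j₂`. -/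
noncomputable def proj2 (d : ℕ) : (Vec d × Vec d × Vec d) →L[ℝ] Vec d :=
  ContinuousLinearMap.snd ℝ _ _ ∘L ContinuousLinearMap.snd ℝ _ _

/-- Linear functions of the fibre are bounded on the ball, so moments fall under the test class. The
constant `c` is chosen before `G`, so the bounds scale with that of `G`. -/
theorem isTest_proj (hc : IsContractive (stepJ α Abar At e) N β r)
    (p : (Vec d × Vec d × Vec d) →L[ℝ] Vec d) :
    ∃ c, 0 ≤ c ∧ ∀ (G : Z → Mat d) (C : ℝ), StronglyMeasurable G → 0 ≤ C → (∀ z, ‖G z‖ ≤ C) →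
      IsTest N r (fun q : Z × Vec d × Vec d × Vec d => G q.1 (p q.2)) (C * (c * r)) (C * c) := by
  obtain ⟨c, hcN⟩ := hc.exists_norm_le
  have hc' : ∀ u, ‖p u‖ ≤ ‖p‖ * |c| * N u := fun u => by
    rw [mul_assoc]
    exact norm_apply_le_mul le_rfl
      ((hcN u).trans (mul_le_mul_of_nonneg_right (le_abs_self c) (apply_nonneg _ _)))
  refine ⟨‖p‖ * |c|, by positivity, fun G C hG hC0 hC =>
    ⟨?_, by positivity, fun z u hu => ?_, fun z u v _ _ => ?_⟩⟩
  · exact stronglyMeasurable_apply (hG.comp_measurable measurable_fst)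
      (p.measurable.comp measurable_snd).stronglyMeasurable
  · exact norm_apply_le_mul (hC z) ((hc' u).trans (by gcongr))
  · rw [← map_sub, ← map_sub, mul_assoc]
    exact norm_apply_le_mul (hC z) (hc' _)

theorem skewOp_proj {st : Z × (Vec d × Vec d × Vec d) → Vec d × Vec d × Vec d} {G : Z → Mat d}
    {C : ℝ} (hG : StronglyMeasurable G) (hC : ∀ z, ‖G z‖ ≤ C)
    (p : (Vec d × Vec d × Vec d) →L[ℝ] Vec d) (q : Z × Vec d × Vec d × Vec d) :
    skewOp Q st (fun q => G q.1 (p q.2)) q = avg Q 1 G q.1 (p (st q)) := by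
  simp only [skewOp, avg, pow_one]
  exact (ContinuousLinearMap.integral_apply (integrable_of_norm_le hG hC) _).symm

theorem hasSum_of_telescope {V : Type*} [NormedAddCommGroup V] [CompleteSpace V] {a b : ℕ → V}
    {g : ℕ → ℝ} (hab : ∀ n, a n = a (n + 1) + b n) (ha : Tendsto a atTop (𝓝 0))
    (hg : Summable g) (hb : ∀ n, ‖b n‖ ≤ g n) : HasSum b (a 0) := by
  have hs : Summable b := Summable.of_norm_bounded hg hb
  refine (hs.hasSum_iff_tendsto_nat).2 ?_
  have h1 : ∀ n, ∑ i ∈ Finset.range n, b i = a 0 - a n := fun n => by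
    induction n with
    | zero => simp
    | succ n ih => rw [Finset.sum_range_succ, ih, hab n]; abel
  simp only [h1]
  simpa using ha.const_sub (a 0)

variable (hc : IsContractive (stepJ α Abar At e) N β r)
  (hPi : (skewKernel Q (stepJ α Abar At e) hst).Invariant Pi)

include hc hPi

/-- Invariance applied to `G(Z) J¹`: one step replaces it by `(QG)(z) (B j₁ - α At(z) j₀)`. -/
theorem integral_apply_proj1_eq (hAt : StronglyMeasurable At) (hCA : ∀ z, ‖At z‖ ≤ CA)
    {G : Z → Mat d} {C : ℝ} (hG : StronglyMeasurable G) (hC0 : 0 ≤ C) (hC : ∀ z, ‖G z‖ ≤ C) :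
    ∫ q, G q.1 (proj1 d q.2) ∂Pi = ∫ q, (avg Q 1 G q.1 * (1 - α • Abar)) (proj1 d q.2) ∂Pi -
      α • ∫ q, (avg Q 1 G q.1 * At q.1) (proj0 d q.2) ∂Pi := by
  have hb := ae_ball_of_invariant hc hPi
  obtain ⟨c1, -, h1⟩ := isTest_proj hc (proj1 d)
  obtain ⟨c0, -, h0⟩ := isTest_proj hc (proj0 d)
  have hav := stronglyMeasurable_avg (Q := Q) 1 hG
  have hav' := norm_avg_le (Q := Q) 1 hC
  have hCA0 : 0 ≤ max CA 0 := le_max_right _ _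
  have i1 := (h1 _ _ (hav.mul_const (1 - α • Abar)) (by positivity)
    (fun z => norm_mul_le_mul (hav' z) le_rfl)).integrable hb
  have i0 := (h0 _ _ (hav.mul hAt) (by positivity)
    (fun z => norm_mul_le_mul (hav' z) ((hCA z).trans (le_max_left _ 0)))).integrable hb
  have i0' : Integrable (fun q : Z × Vec d × Vec d × Vec d =>
      α • (avg Q 1 G q.1 * At q.1) (proj0 d q.2)) Pi := i0.smul α
  rw [integral_eq_integral_skewOp hc hPi (h1 G C hG hC0 hC), ← integral_smul,
    ← integral_sub i1 i0']
  refine integral_congr_ae (Eventually.of_forall fun q => ?_)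
  dsimp only
  rw [skewOp_proj hG hC]
  change avg Q 1 G q.1 ((1 - α • Abar) q.2.2.1 - α • At q.1 q.2.1) = _
  rw [map_sub, map_smul]
  rfl

theorem integral_apply_proj0_eq (hπ : Q.Invariant π) {s : ℕ → ℝ}
    (hs : ∀ n, 1 ≤ n → dobrushin (Q ^ n) ≤ s n) (hs0 : Tendsto s atTop (𝓝 0))
    (he : StronglyMeasurable e) (hCe : ∀ z, ‖e z‖ ≤ Ce)
    {G : Z → Mat d} {C : ℝ} (hG : StronglyMeasurable G) (hC0 : 0 ≤ C) (hC : ∀ z, ‖G z‖ ≤ C) :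
    ∫ q, G q.1 (proj0 d q.2) ∂Pi = ∫ q, (avg Q 1 G q.1 * (1 - α • Abar)) (proj0 d q.2) ∂Pi -
      α • ∫ z, avg Q 1 G z (e z) ∂π := by
  have hb := ae_ball_of_invariant hc hPi
  obtain ⟨c0, -, h0⟩ := isTest_proj hc (proj0 d)
  have hav := stronglyMeasurable_avg (Q := Q) 1 hG
  have hav' := norm_avg_le (Q := Q) 1 hC
  have i0 := (h0 _ _ (hav.mul_const (1 - α • Abar)) (by positivity)
    (fun z => norm_mul_le_mul (hav' z) le_rfl)).integrable hb
  have he1 := stronglyMeasurable_apply hav he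
  have he2 := fun z => norm_apply_le_mul (hav' z) (hCe z)
  have ie : Integrable (fun q : Z × Vec d × Vec d × Vec d => avg Q 1 G q.1 (e q.1)) Pi :=
    integrable_of_norm_le (he1.comp_measurable measurable_fst) (fun q => he2 q.1)
  have ie' : Integrable (fun q : Z × Vec d × Vec d × Vec d =>
      α • avg Q 1 G q.1 (e q.1)) Pi := ie.smul α
  rw [integral_eq_integral_skewOp hc hPi (h0 G C hG hC0 hC),
    ← integral_fst_of_invariant hc hPi hπ hs hs0 he1 he2, ← integral_smul,
    ← integral_sub i0 ie']
  refine integral_congr_ae (Eventually.of_forall fun q => ?_)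
  dsimp only
  rw [skewOp_proj hG hC]
  change avg Q 1 G q.1 ((1 - α • Abar) q.2.1 - α • e q.1) = _
  rw [map_sub, map_smul]
  rfl

/-- The stationary mean `m` of the recursion for `J²` satisfies `m = m - α (Abar m + E[At J¹])`. -/
theorem apply_integral_proj2 (hα : α ≠ 0) (hAt : StronglyMeasurable At)
    (hCA : ∀ z, ‖At z‖ ≤ CA) :
    Abar (∫ q, q.2.2.2 ∂Pi) = -∫ q, At q.1 (proj1 d q.2) ∂Pi := by
  have hb := ae_ball_of_invariant hc hPi
  obtain ⟨c2, -, h2⟩ := isTest_proj hc (proj2 d)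
  obtain ⟨c1, -, h1⟩ := isTest_proj hc (proj1 d)
  have t2 := h2 (fun _ => 1) _ stronglyMeasurable_const (norm_nonneg _) (fun _ => le_rfl)
  have i2 : Integrable (fun q : Z × Vec d × Vec d × Vec d => q.2.2.2) Pi := t2.integrable hb
  have i1 := (h1 At (max CA 0) hAt (le_max_right _ _)
    (fun z => (hCA z).trans (le_max_left _ _))).integrable hb
  have h := integral_eq_integral_skewOp hc hPi t2
  have h3 : ∀ q : Z × Vec d × Vec d × Vec d, skewOp Q (stepJ α Abar At e)
      (fun q => (1 : Mat d) (proj2 d q.2)) q =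
        q.2.2.2 - α • (Abar q.2.2.2 + At q.1 (proj1 d q.2)) := fun q => by
    simp only [skewOp, integral_const, probReal_univ, one_smul]
    change (1 - α • Abar) q.2.2.2 - α • At q.1 q.2.2.1 = _
    simp only [sub_apply, one_apply_eq_self, smul_apply, smul_add, sub_sub]
    rfl
  simp only [h3] at h
  have iA : Integrable (fun q : Z × Vec d × Vec d × Vec d => Abar q.2.2.2) Pi :=
    Abar.integrable_comp i2
  have iS : Integrable (fun q : Z × Vec d × Vec d × Vec d =>
      α • (Abar q.2.2.2 + At q.1 (proj1 d q.2))) Pi := (iA.add i1).smul α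
  rw [integral_sub i2 iS, integral_smul, integral_add iA i1,
    Abar.integral_comp_comm i2] at h
  change ∫ q, q.2.2.2 ∂Pi = _ at h
  have h4 := sub_eq_self.1 h.symm
  exact eq_neg_of_add_eq_zero_left ((smul_eq_zero.1 h4).resolve_left hα)

/-- Iterate the one-step identity from `G = At`: after `k` steps `G` has become `Qᵏ At · Bᵏ`, whose
norm decays geometrically because `‖Bᵏ‖` does, and the terms split off are the `J⁰`-moments of
`corrFun`. -/
theorem hasSum_integral_proj1 (hAt : StronglyMeasurable At) (hCA : ∀ z, ‖At z‖ ≤ CA) {K b : ℝ}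
    (hb0 : 0 ≤ b) (hb1 : b < 1) (hpow : ∀ n, ‖(1 - α • Abar) ^ n‖ ≤ K * b ^ n) :
    HasSum (fun k => -(α • ∫ q, corrFun Q At ((1 - α • Abar) ^ k) k q.1 (proj0 d q.2) ∂Pi))
      (∫ q, At q.1 (proj1 d q.2) ∂Pi) := by
  have hb := ae_ball_of_invariant hc hPi
  set B := 1 - α • Abar with hB
  have hK : 0 ≤ K := by simpa using (norm_nonneg _).trans (hpow 0)
  have hCA' : ∀ z, ‖At z‖ ≤ max CA 0 := fun z => (hCA z).trans (le_max_left _ _)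
  have hCA0 : 0 ≤ max CA 0 := le_max_right _ _
  obtain ⟨c1, hc1, h1⟩ := isTest_proj hc (proj1 d)
  obtain ⟨c0, hc0, h0⟩ := isTest_proj hc (proj0 d)
  have hr := hc.radius_nonneg
  have hGk := fun k => (stronglyMeasurable_avg (Q := Q) k hAt).mul_const (B ^ k)
  have hGb : ∀ k z, ‖avg Q k At z * B ^ k‖ ≤ max CA 0 * (K * b ^ k) := fun k z =>
    norm_mul_le_mul (norm_avg_le _ hCA' z) (hpow k)
  have hzero : ∫ q, At q.1 (proj1 d q.2) ∂Pi = ∫ q, (avg Q 0 At q.1 * B ^ 0) (proj1 d q.2) ∂Pi := by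
    rw [avg_zero hAt, pow_zero]; simp only [mul_one]
  have hgeo := summable_geometric_of_lt_one hb0 hb1
  have hgeo0 := tendsto_pow_atTop_nhds_zero_of_lt_one hb0 hb1
  rw [hzero]
  refine hasSum_of_telescope (a := fun k => ∫ q, (avg Q k At q.1 * B ^ k) (proj1 d q.2) ∂Pi)
    (g := fun k => |α| * (max CA 0 * (K * b ^ k) * max CA 0 * (c0 * r))) (fun k => ?_) ?_ ?_
    (fun k => ?_)
  · have h := integral_apply_proj1_eq hc hPi hAt hCA (hGk k) (by positivity) (hGb k)
    rw [avg_mul_const (stronglyMeasurable_avg k hAt) (norm_avg_le k hCA'), avg_avg 1 k hAt hCA'] at h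
    simp only [mul_assoc, ← hB, ← pow_succ] at h
    simp only [corrFun, mul_assoc]
    rw [h, sub_eq_add_neg]
  · refine squeeze_zero_norm (a := fun k => max CA 0 * (K * b ^ k) * (c1 * r)) (fun k => ?_) ?_
    · exact norm_integral_le_of_norm_le_prob (hb.mono fun q hq =>
        (h1 _ _ (hGk k) (by positivity) (hGb k)).bound q.1 q.2 hq)
    · simpa using ((hgeo0.const_mul K).const_mul (max CA 0)).mul_const (c1 * r)
  · exact ((((hgeo.mul_left K).mul_left (max CA 0)).mul_right _).mul_right _).mul_left _
  · rw [norm_neg, norm_smul, Real.norm_eq_abs]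
    refine mul_le_mul_of_nonneg_left ?_ (abs_nonneg α)
    have hH : ∀ z, ‖corrFun Q At (B ^ k) k z‖ ≤ max CA 0 * (K * b ^ k) * max CA 0 := fun z =>
      norm_mul_le_mul (norm_mul_le_mul (norm_avg_le _ hCA' z) (hpow k)) (hCA' z)
    exact norm_integral_le_of_norm_le_prob (hb.mono fun q hq =>
      (h0 _ _ (stronglyMeasurable_corrFun hAt _ k) (by positivity) hH).bound q.1 q.2 hq)

/-- The same iteration one level lower; the terms split off now depend on the base alone and are
integrals over `π`. -/
theorem hasSum_integral_proj0 (hπ : Q.Invariant π) {s : ℕ → ℝ}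
    (hs : ∀ n, 1 ≤ n → dobrushin (Q ^ n) ≤ s n) (hs0 : Tendsto s atTop (𝓝 0))
    (he : StronglyMeasurable e) (hCe : ∀ z, ‖e z‖ ≤ Ce) {K b : ℝ}
    (hb0 : 0 ≤ b) (hb1 : b < 1) (hpow : ∀ n, ‖(1 - α • Abar) ^ n‖ ≤ K * b ^ n)
    {H : Z → Mat d} {C : ℝ} (hH : StronglyMeasurable H) (hC0 : 0 ≤ C) (hC : ∀ z, ‖H z‖ ≤ C) :
    HasSum (fun i => -(α • ∫ z, avg Q (i + 1) H z (((1 - α • Abar) ^ i) (e z)) ∂π))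
      (∫ q, H q.1 (proj0 d q.2) ∂Pi) := by
  have hb := ae_ball_of_invariant hc hPi
  set B := 1 - α • Abar with hB
  have hK : 0 ≤ K := by simpa using (norm_nonneg _).trans (hpow 0)
  obtain ⟨c0, hc0, h0⟩ := isTest_proj hc (proj0 d)
  have hr := hc.radius_nonneg
  have hGk := fun k => (stronglyMeasurable_avg (Q := Q) k hH).mul_const (B ^ k)
  have hGb : ∀ k z, ‖avg Q k H z * B ^ k‖ ≤ C * (K * b ^ k) := fun k z =>
    norm_mul_le_mul (norm_avg_le _ hC z) (hpow k)
  have hzero : ∫ q, H q.1 (proj0 d q.2) ∂Pi = ∫ q, (avg Q 0 H q.1 * B ^ 0) (proj0 d q.2) ∂Pi := by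
    rw [avg_zero hH, pow_zero]; simp only [mul_one]
  have hgeo := summable_geometric_of_lt_one hb0 hb1
  have hgeo0 := tendsto_pow_atTop_nhds_zero_of_lt_one hb0 hb1
  rw [hzero]
  refine hasSum_of_telescope (a := fun k => ∫ q, (avg Q k H q.1 * B ^ k) (proj0 d q.2) ∂Pi)
    (g := fun k => |α| * (C * (K * b ^ k * Ce))) (fun k => ?_) ?_ ?_
    (fun k => ?_)
  · have h := integral_apply_proj0_eq hc hPi hπ hs hs0 he hCe (hGk k) (by positivity) (hGb k)
    rw [avg_mul_const (stronglyMeasurable_avg k hH) (norm_avg_le k hC), avg_avg 1 k hH hC] at h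
    simp only [mul_assoc, ← hB, ← pow_succ] at h
    rw [h, sub_eq_add_neg]
    rfl
  · refine squeeze_zero_norm (a := fun k => C * (K * b ^ k) * (c0 * r)) (fun k => ?_) ?_
    · exact norm_integral_le_of_norm_le_prob (hb.mono fun q hq =>
        (h0 _ _ (hGk k) (by positivity) (hGb k)).bound q.1 q.2 hq)
    · simpa using ((hgeo0.const_mul K).const_mul C).mul_const (c0 * r)
  · exact ((((hgeo.mul_left K)).mul_right Ce).mul_left C).mul_left _
  · rw [norm_neg, norm_smul, Real.norm_eq_abs]
    refine mul_le_mul_of_nonneg_left ?_ (abs_nonneg α)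
    exact norm_integral_le_of_norm_le_prob (Eventually.of_forall fun z =>
      norm_apply_le_mul (norm_avg_le _ hC z) (norm_apply_le_mul (hpow k) (hCe z)))

theorem integral_proj1_eq_tsum_corr (hπ : Q.Invariant π) {s : ℕ → ℝ}
    (hs : ∀ n, 1 ≤ n → dobrushin (Q ^ n) ≤ s n) (hs0 : Tendsto s atTop (𝓝 0))
    (hAt : StronglyMeasurable At) (hCA : ∀ z, ‖At z‖ ≤ CA)
    (he : StronglyMeasurable e) (hCe : ∀ z, ‖e z‖ ≤ Ce) {K b : ℝ}
    (hb0 : 0 ≤ b) (hb1 : b < 1) (hpow : ∀ n, ‖(1 - α • Abar) ^ n‖ ≤ K * b ^ n) :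
    ∫ q, At q.1 (proj1 d q.2) ∂Pi =
      α ^ 2 • ∑' k, ∑' i, corr Q π At e ((1 - α • Abar) ^ k) ((1 - α • Abar) ^ i) k i := by
  have hCA' : ∀ z, ‖At z‖ ≤ max CA 0 := fun z => (hCA z).trans (le_max_left _ _)
  have hCA0 : 0 ≤ max CA 0 := le_max_right _ _
  rw [← (hasSum_integral_proj1 hc hPi hAt hCA hb0 hb1 hpow).tsum_eq, ← tsum_const_smul'']
  refine tsum_congr fun k => ?_
  rw [← (hasSum_integral_proj0 hc hPi hπ hs hs0 he hCe hb0 hb1 hpow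
    (stronglyMeasurable_corrFun hAt ((1 - α • Abar) ^ k) k) (by positivity)
    (norm_corrFun_le hCA' _ k)).tsum_eq, ← tsum_const_smul'', ← tsum_neg, ← tsum_const_smul'']
  refine tsum_congr fun i => ?_
  rw [smul_neg, neg_neg, smul_smul, sq]
  rfl

end Moments

/-! ### Sums of mixing rates and the final constant -/

section Numeric

/-- Writing `k = q t + j` with `j < t` factors the series into a geometric one with ratio `y^t / 4`
and a finite sum over `j`. -/
theorem tsum_block_geometric {t : ℕ} (ht : 1 ≤ t) {y : ℝ} (hy : 0 ≤ y) (hyt : y ^ t < 4) :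
    HasSum (fun k : ℕ => (1 / 4 : ℝ) ^ (k / t) * y ^ k)
      ((1 - y ^ t / 4)⁻¹ * ∑ j ∈ Finset.range t, y ^ j) := by
  have : NeZero t := ⟨by omega⟩
  have h1 : HasSum (fun q : ℕ => (y ^ t / 4) ^ q) (1 - y ^ t / 4)⁻¹ :=
    hasSum_geometric_of_lt_one (by positivity) (by linarith)
  have h2 : HasSum (fun j : Fin t => y ^ (j : ℕ)) (∑ j ∈ Finset.range t, y ^ j) := by
    rw [← Fin.sum_univ_eq_sum_range]
    exact hasSum_fintype _
  have h3 := h1.mul h2 (h1.summable.mul_of_nonneg h2.summable (fun q => by positivity)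
    (fun j => by positivity))
  rw [← (Nat.divModEquiv t).hasSum_iff] at h3
  refine h3.congr_fun fun k => ?_
  change _ = (y ^ t / 4) ^ (k / t) * y ^ (k % t)
  have h4 : y ^ k = (y ^ t) ^ (k / t) * y ^ (k % t) := by
    rw [← pow_mul, ← pow_add, Nat.div_add_mod]
  rw [h4, ← mul_assoc, ← mul_pow]
  congr 2
  ring

theorem block_sum_sq_sub_le {t : ℕ} (ht : 1 ≤ t) {x : ℝ} (hx : 0 ≤ x) (hxt : x * t ≤ 1 / 8) :
    ((1 - (1 + x) ^ t / 4)⁻¹ * ∑ j ∈ Finset.range t, (1 + x) ^ j) ^ 2 -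
      ((1 - (1 : ℝ) ^ t / 4)⁻¹ * ∑ j ∈ Finset.range t, (1 : ℝ) ^ j) ^ 2 ≤ 12 * x * t ^ 3 := by
  set u := (1 + x) ^ t with hu
  have hs : ∑ j ∈ Finset.range t, (1 + x) ^ j ≤ t * u := by
    calc _ ≤ ∑ j ∈ Finset.range t, u := Finset.sum_le_sum fun j hj =>
          pow_le_pow_right₀ (by linarith) (Finset.mem_range.1 hj).le
      _ = _ := by simp
  have hs0 : 0 ≤ ∑ j ∈ Finset.range t, (1 + x) ^ j := Finset.sum_nonneg fun j _ => by positivity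
  have hu1 : u - 1 ≤ x * (t * u) := by
    have h := geom_sum_mul (1 + x) t
    rw [← hu, add_sub_cancel_left] at h
    rw [← h, mul_comm]
    exact mul_le_mul_of_nonneg_left hs hx
  have hu0 : 1 ≤ u := one_le_pow₀ (by linarith)
  -- From `u - 1 ≤ x t u ≤ u / 8`.
  have hu2 : u ≤ 8 / 7 := by nlinarith
  have ht0 : (0 : ℝ) ≤ t := Nat.cast_nonneg t
  have hd : (20 / 7 : ℝ) ≤ 4 - u := by linarith
  have h4 : (1 - u / 4)⁻¹ = 4 / (4 - u) := by
    rw [show 1 - u / 4 = (4 - u) / 4 by ring, inv_div]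
  have e1 : (1 - u / 4)⁻¹ * ∑ j ∈ Finset.range t, (1 + x) ^ j ≤ t * (4 * u / (4 - u)) := by
    rw [h4]
    calc _ ≤ 4 / (4 - u) * (t * u) := by
          have : 0 ≤ 4 / (4 - u) := div_nonneg (by norm_num) (by linarith)
          gcongr
      _ = _ := by ring
  have e0 : 0 ≤ (1 - u / 4)⁻¹ * ∑ j ∈ Finset.range t, (1 + x) ^ j := by
    rw [h4]; exact mul_nonneg (div_nonneg (by norm_num) (by linarith)) hs0
  -- The left side is convex in `u` and equals `4/3` at `u = 1`; its chord over `[1, 8/7]` has slope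
  -- `28/15 < 5/2`.
  have e2 : 4 * u / (4 - u) ≤ 4 / 3 + 5 / 2 * (u - 1) := by
    rw [div_le_iff₀ (by linarith)]
    nlinarith [mul_nonneg (sub_nonneg.2 hu0) (sub_nonneg.2 hu2)]
  have e3 : ((1 - (1 : ℝ) ^ t / 4)⁻¹ * ∑ j ∈ Finset.range t, (1 : ℝ) ^ j) = t * (4 / 3) := by
    simp only [one_pow, Finset.sum_const, Finset.card_range, nsmul_eq_mul, mul_one]
    norm_num; ring
  set v := u - 1 with hv
  have hv0 : 0 ≤ v := by linarith
  have hv1 : v ≤ 8 / 7 * (x * t) := by nlinarith [mul_nonneg hx ht0]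
  rw [e3]
  have e4 : ((1 - u / 4)⁻¹ * ∑ j ∈ Finset.range t, (1 + x) ^ j) ^ 2 ≤
      (t * (4 / 3 + 5 / 2 * v)) ^ 2 :=
    pow_le_pow_left₀ e0 (e1.trans (mul_le_mul_of_nonneg_left e2 ht0)) 2
  -- The difference is `20/3 v + 25/4 v²`. With `v ≤ 1/7` and `v ≤ 8/7 x t` it is below `9 x t`.
  have e5 : (4 / 3 + 5 / 2 * v) ^ 2 - (4 / 3) ^ 2 ≤ 12 * (x * t) := by
    nlinarith [mul_nonneg hv0 (show 0 ≤ 1 / 7 - v by linarith)]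
  calc _ ≤ (t : ℝ) ^ 2 * ((4 / 3 + 5 / 2 * v) ^ 2 - (4 / 3) ^ 2) := by
        rw [mul_pow] at e4; rw [mul_pow (t : ℝ) (4 / 3)]; linarith
    _ ≤ (t : ℝ) ^ 2 * (12 * (x * t)) := by gcongr
    _ = _ := by ring

/-- The mixing rate `(1/4)^⌊n/t⌋`. -/
noncomputable def mixRate (t n : ℕ) : ℝ := (1 / 4 : ℝ) ^ (n / t)

theorem mixRate_nonneg (t n : ℕ) : 0 ≤ mixRate t n := by unfold mixRate; positivity

theorem mixRate_succ_le (t n : ℕ) : mixRate t (n + 1) ≤ mixRate t n :=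
  pow_le_pow_of_le_one (by norm_num) (by norm_num) (Nat.div_le_div_right (Nat.le_succ n))

theorem tendsto_mixRate {t : ℕ} (ht : 1 ≤ t) : Tendsto (mixRate t) atTop (𝓝 0) :=
  (tendsto_pow_atTop_nhds_zero_of_lt_one (by norm_num) (by norm_num)).comp
    (Nat.tendsto_div_const_atTop (by omega))

theorem hasSum_mixRate_mul {t : ℕ} (ht : 1 ≤ t) {y : ℝ} (hy : 0 ≤ y) (hyt : y ^ t < 4) :
    HasSum (fun q : ℕ × ℕ => mixRate t q.1 * mixRate t q.2 * y ^ (q.1 + q.2))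
      (((1 - y ^ t / 4)⁻¹ * ∑ j ∈ Finset.range t, y ^ j) ^ 2) := by
  have h := tsum_block_geometric ht hy hyt
  have hn : ∀ k : ℕ, 0 ≤ (1 / 4 : ℝ) ^ (k / t) * y ^ k := fun k => by positivity
  rw [sq]
  refine (h.mul h (h.summable.mul_of_nonneg h.summable hn hn)).congr_fun fun q => ?_
  unfold mixRate
  rw [pow_add]
  ring

theorem summable_mixRate_succ_mul {t : ℕ} (ht : 1 ≤ t) :
    Summable fun q : ℕ × ℕ => mixRate t (q.1 + 1) * mixRate t (q.2 + 1) := by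
  have h := (hasSum_mixRate_mul ht zero_le_one (by rw [one_pow]; norm_num)).summable
  simp only [one_pow, mul_one] at h
  exact h.of_nonneg_of_le (fun q => mul_nonneg (mixRate_nonneg _ _) (mixRate_nonneg _ _))
    (fun q => mul_le_mul (mixRate_succ_le _ _) (mixRate_succ_le _ _) (mixRate_nonneg _ _)
      (mixRate_nonneg _ _))

/-- The rates decrease, so the shift by one can be dropped. The remaining sum is the difference of
the closed forms at `y = 1 + x` and `y = 1`; the first converges because `(1 + x)^t ≤ exp (x t) <
4`. -/
theorem summable_and_tsum_mixRate_le {t : ℕ} (ht : 1 ≤ t) {x : ℝ} (hx : 0 ≤ x)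
    (hxt : x * t ≤ 1 / 8) :
    (Summable fun q : ℕ × ℕ =>
      mixRate t (q.1 + 1) * mixRate t (q.2 + 1) * ((1 + x) ^ (q.1 + q.2) - 1)) ∧
    ∑' q : ℕ × ℕ, mixRate t (q.1 + 1) * mixRate t (q.2 + 1) * ((1 + x) ^ (q.1 + q.2) - 1) ≤
      12 * x * t ^ 3 := by
  have hyt : (1 + x) ^ t < 4 := by
    calc (1 + x) ^ t ≤ Real.exp x ^ t := by
          gcongr; linarith [Real.add_one_le_exp x]
      _ = Real.exp (t * x) := by rw [← Real.exp_nat_mul]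
      _ ≤ Real.exp 1 := Real.exp_le_exp.2 (by linarith)
      _ < 4 := by linarith [Real.exp_one_lt_d9]
  have h1 := hasSum_mixRate_mul ht zero_le_one (by rw [one_pow]; norm_num)
  have h2 := (hasSum_mixRate_mul ht (by linarith : 0 ≤ 1 + x) hyt).sub h1
  have hle : ∀ q : ℕ × ℕ,
      mixRate t (q.1 + 1) * mixRate t (q.2 + 1) * ((1 + x) ^ (q.1 + q.2) - 1) ≤
        mixRate t q.1 * mixRate t q.2 * (1 + x) ^ (q.1 + q.2) -
          mixRate t q.1 * mixRate t q.2 * 1 ^ (q.1 + q.2) := fun q => by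
    rw [one_pow, ← mul_sub]
    have : (0 : ℝ) ≤ (1 + x) ^ (q.1 + q.2) - 1 := sub_nonneg.2 (one_le_pow₀ (by linarith))
    gcongr ?_ * _
    exact mul_le_mul (mixRate_succ_le _ _) (mixRate_succ_le _ _) (mixRate_nonneg _ _)
      (mixRate_nonneg _ _)
  have hs := h2.summable.of_nonneg_of_le (fun q => mul_nonneg
    (mul_nonneg (mixRate_nonneg _ _) (mixRate_nonneg _ _))
    (sub_nonneg.2 (one_le_pow₀ (by linarith)))) hle
  exact ⟨hs, (hasSum_le hle hs.hasSum h2).trans (block_sum_sq_sub_le ht hx hxt)⟩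

/-- The left side is at most `48 A³ C α³ t³ = A³ · 24 (2/t) · t⁴ α³ C`; then `2/t ≤ exp (2/t) - 1`,
and `α³ ≤ α^{5/2}` since `α ≤ 1`. `D` stands for the first summand of `constDb`, of which only the
sign matters. -/
theorem rpow_five_halves_bound {α C A t S D : ℝ} (hα : 0 < α) (hα1 : α ≤ 1) (hC : 0 ≤ C)
    (hA : 0 ≤ A) (ht : 1 ≤ t) (hD : 0 ≤ D) (hS : S ≤ 12 * (α * A) * t ^ 3) :
    α ^ 2 * (4 * A ^ 2 * C * S) ≤
      A ^ 3 * (D + 24 * (Real.exp (2 / t) - 1)) * t ^ 4 * α ^ (5 / 2 : ℝ) * C := by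
  have ht0 : 0 < t := by linarith
  have he : 2 / t ≤ Real.exp (2 / t) - 1 := by linarith [Real.add_one_le_exp (2 / t)]
  have hpow : α ^ 3 ≤ α ^ (5 / 2 : ℝ) := by
    rw [← Real.rpow_natCast]
    exact Real.rpow_le_rpow_of_exponent_ge hα hα1 (by norm_num)
  calc _ ≤ α ^ 2 * (4 * A ^ 2 * C * (12 * (α * A) * t ^ 3)) := by gcongr
    _ = A ^ 3 * (24 * (2 / t)) * t ^ 4 * α ^ 3 * C := by field_simp; ring
    _ ≤ _ := by
      have h1 : 0 ≤ 24 * (2 / t) := by positivity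
      have h2 : 24 * (2 / t) ≤ D + 24 * (Real.exp (2 / t) - 1) := by linarith
      have h3 : 0 ≤ D + 24 * (Real.exp (2 / t) - 1) := h1.trans h2
      gcongr

end Numeric

/-! ### The Markov property over several steps -/

section MultiStep

variable {Z : Type*} [MeasurableSpace Z] {Q : Kernel Z Z} [IsMarkovKernel Q]
  {ν : Measure (ℕ → Z)} [IsProbabilityMeasure ν]

theorem trunc_trunc {n m : ℕ} (h : n ≤ m) (y : ℕ → Z) : trunc n (trunc m y) = trunc n y := by
  funext i
  simp only [trunc]
  congr 1
  omega

theorem IsMarkovLaw.lintegral_add (hν : IsMarkovLaw Q ν) (n m : ℕ) {G : (ℕ → Z) × Z → ℝ≥0∞}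
    (hG : Measurable G) :
    ∫⁻ y, G (trunc n y, y (n + m)) ∂ν = ∫⁻ y, ∫⁻ v, G (trunc n y, v) ∂((Q ^ m) (y n)) ∂ν := by
  induction m generalizing G with
  | zero =>
    refine lintegral_congr fun y => ?_
    rw [pow_zero, add_zero]
    exact (lintegral_dirac' _ (hG.comp measurable_prodMk_left)).symm
  | succ m ih =>
    have h1 := hν (n + m) (fun p => G (trunc n p.1, p.2))
      (hG.comp (((measurable_trunc n).comp measurable_fst).prodMk measurable_snd))
    simp only [trunc_trunc (Nat.le_add_right n m)] at h1
    have h2 := ih (G := fun p => ∫⁻ v, G (p.1, v) ∂(Q p.2))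
      (Measurable.lintegral_kernel_prod_right' (κ := Q.comap (fun p : (ℕ → Z) × Z => p.2)
        measurable_snd) (f := fun p : ((ℕ → Z) × Z) × Z => G (p.1.1, p.2))
        (hG.comp ((measurable_fst.comp measurable_fst).prodMk measurable_snd)))
    rw [← add_assoc, h1, h2]
    refine lintegral_congr fun y => ?_
    rw [show (Q ^ (m + 1)) = Q ∘ₖ (Q ^ m) from pow_succ' Q m]
    exact (Kernel.lintegral_comp _ _ _ (hG.comp measurable_prodMk_left)).symm

theorem IsMarkovLaw.map_trunc_add (hν : IsMarkovLaw Q ν) (n m : ℕ) :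
    ν.map (fun y => (trunc n y, y (n + m))) =
      (ν.map (trunc n)) ⊗ₘ ((Q ^ m).comap (fun y : ℕ → Z => y n) (measurable_pi_apply n)) := by
  refine Measure.ext_of_lintegral _ fun f hf => ?_
  have hm := Measurable.lintegral_kernel_prod_right'
    (κ := (Q ^ m).comap (fun y : ℕ → Z => y n) (measurable_pi_apply n)) hf
  rw [lintegral_map hf ((measurable_trunc n).prodMk (measurable_pi_apply _)),
    Measure.lintegral_compProd hf, lintegral_map hm (measurable_trunc n), hν.lintegral_add n m hf]
  simp only [Kernel.comap_apply, trunc_self]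

theorem IsMarkovLaw.integral_add {F : Type*} [NormedAddCommGroup F] [NormedSpace ℝ F]
    (hν : IsMarkovLaw Q ν) (n m : ℕ) {f : (ℕ → Z) × Z → F} {C : ℝ} (hf : StronglyMeasurable f)
    (hC : ∀ p, ‖f p‖ ≤ C) :
    ∫ y, f (trunc n y, y (n + m)) ∂ν = ∫ y, ∫ v, f (trunc n y, v) ∂((Q ^ m) (y n)) ∂ν := by
  have htm := measurable_trunc (Z := Z) n
  have hp : IsProbabilityMeasure (ν.map (trunc n)) := Measure.isProbabilityMeasure_map htm.aemeasurable
  set κ := (Q ^ m).comap (fun y : ℕ → Z => y n) (measurable_pi_apply n) with hκ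
  rw [← integral_map (φ := fun y : ℕ → Z => (trunc n y, y (n + m)))
    (htm.prodMk (measurable_pi_apply _)).aemeasurable hf.aestronglyMeasurable,
    hν.map_trunc_add, Measure.integral_compProd (integrable_of_norm_le hf hC),
    integral_map htm.aemeasurable]
  · simp only [Kernel.comap_apply, trunc_self]
  · exact (StronglyMeasurable.integral_kernel_prod_right (κ := κ) (f := fun y v => f (y, v))
      hf).aestronglyMeasurable

theorem IsMarkovChain.isMarkovLaw {Ω : Type*} [MeasurableSpace Ω] {P : Measure Ω}
    [IsProbabilityMeasure P] {X : ℕ → Ω → Z} (hX : IsMarkovChain Q P X) :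
    IsMarkovLaw Q (P.map fun ω n => X n ω) := by
  intro n G hG
  have hXm : Measurable fun ω n => X n ω := measurable_pi_iff.2 hX.measurable
  -- A finite history becomes a path by freezing it at its last point, in agreement with `trunc n`.
  let e : (Fin (n + 1) → Z) → ℕ → Z := fun x i => x ⟨min i n, by omega⟩
  have he : Measurable e := measurable_pi_iff.2 fun _ => measurable_pi_apply _
  have hGe : Measurable fun q : (Fin (n + 1) → Z) × Z => G (e q.1, q.2) :=
    hG.comp ((he.comp measurable_fst).prodMk measurable_snd)
  have hH : Measurable fun ω => fun i : Fin (n + 1) => X i ω :=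
    measurable_pi_iff.2 fun i => hX.measurable i
  have h2 := congrArg (fun m => ∫⁻ q, G (e q.1, q.2) ∂m) (hX.transition n)
  rw [Measure.lintegral_compProd hGe, lintegral_map hGe (hH.prodMk (hX.measurable _)),
    lintegral_map (Measurable.lintegral_kernel_prod_right'
      (κ := Q.comap (fun h : Fin (n + 1) → Z => h (Fin.last n)) (measurable_pi_apply _)) hGe)
      hH] at h2
  have hGt : Measurable fun y : ℕ → Z => G (trunc n y, y (n + 1)) :=
    hG.comp ((measurable_trunc n).prodMk (measurable_pi_apply _))
  have hK : Measurable fun y : ℕ → Z => ∫⁻ v, G (trunc n y, v) ∂(Q (y n)) :=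
    Measurable.lintegral_kernel_prod_right' (κ := Q.comap (fun y : ℕ → Z => y n)
      (measurable_pi_apply n)) (f := fun p : (ℕ → Z) × Z => G (trunc n p.1, p.2))
      (hG.comp (((measurable_trunc n).comp measurable_fst).prodMk measurable_snd))
  rw [lintegral_map hGt hXm, lintegral_map hK hXm]
  exact h2

end MultiStep

/-! ### From the given chains to kernels and law sequences -/

section Stationary

variable {d : ℕ} {Z : Type*} [MeasurableSpace Z] {Q : Kernel Z Z} [IsMarkovKernel Q]
  {π : Measure Z} [IsProbabilityMeasure π] {At : Z → Mat d} {e : Z → Vec d} {CA Ce : ℝ}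
  {Ω : Type*} [MeasurableSpace Ω] {P : Measure Ω} [IsProbabilityMeasure P] {X : ℕ → Ω → Z}

/-- Conditioning at time `i + 1` replaces the last factor by `Qᵏ⁺¹ At`, and conditioning at time `0`
then replaces the resulting `corrFun` by its `Qⁱ⁺¹`-average. -/
theorem corrTerm_eq_corr (hX : IsMarkovChain Q P X) (hX0 : P.map (X 0) = π)
    (hAt : StronglyMeasurable At) (hCA : ∀ z, ‖At z‖ ≤ CA) (he : StronglyMeasurable e)
    (hCe : ∀ z, ‖e z‖ ≤ Ce) (k i : ℕ) :
    corrTerm P X At e (k + 1) i = corr Q π At e 1 1 k i := by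
  have hXm : Measurable fun ω n => X n ω := measurable_pi_iff.2 hX.measurable
  set ν := P.map fun ω n => X n ω with hν
  have hp : IsProbabilityMeasure ν := Measure.isProbabilityMeasure_map hXm.aemeasurable
  have hM : IsMarkovLaw Q ν := hX.isMarkovLaw
  have hev : ∀ j, Measurable fun y : ℕ → Z => y j := fun j => measurable_pi_apply j
  have hAy := fun j => hAt.comp_measurable (hev j)
  have hey := he.comp_measurable (hev 0)
  have hν0 : ν.map (fun y => y 0) = π := by
    rw [hν, Measure.map_map (hev 0) hXm, ← hX0]; rfl
  have e0 : corrTerm P X At e (k + 1) i =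
      ∫ y, At (y (i + 1 + (k + 1))) (At (y (i + 1)) (e (y 0))) ∂ν := by
    have hs : StronglyMeasurable fun y : ℕ → Z =>
        At (y (i + 1 + (k + 1))) (At (y (i + 1)) (e (y 0))) :=
      stronglyMeasurable_apply (hAy _) (stronglyMeasurable_apply (hAy _) hey)
    rw [hν, integral_map hXm.aemeasurable hs.aestronglyMeasurable]
    unfold corrTerm
    rw [show k + 1 + i + 1 = i + 1 + (k + 1) by ring]
  have e1 := hM.integral_add (i + 1) (k + 1)
    (f := fun p : (ℕ → Z) × Z => At p.2 (At (p.1 (i + 1)) (e (p.1 0)))) (C := CA * (CA * Ce))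
    (stronglyMeasurable_apply (hAt.comp_measurable measurable_snd) ((stronglyMeasurable_apply
      (hAy _) hey).comp_measurable measurable_fst))
    (fun p => norm_apply_le_mul (hCA _) (norm_apply_le_mul (hCA _) (hCe _)))
  simp only [trunc_self, trunc_zero] at e1
  have e2 := hM.integral_add 0 (i + 1)
    (f := fun p : (ℕ → Z) × Z => corrFun Q At 1 k p.2 (e (p.1 0))) (C := CA * ‖(1 : Mat d)‖ * CA * Ce)
    (stronglyMeasurable_apply ((stronglyMeasurable_corrFun hAt 1 k).comp_measurable measurable_snd)
      (hey.comp_measurable measurable_fst))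
    (fun p => norm_apply_le_mul (norm_corrFun_le hCA 1 k _) (hCe _))
  simp only [trunc_zero, zero_add] at e2
  have e3 : ∫ y, ∫ v, At v (At (y (i + 1)) (e (y 0))) ∂((Q ^ (k + 1)) (y (i + 1))) ∂ν =
      ∫ y, corrFun Q At 1 k (y (i + 1)) (e (y 0)) ∂ν := by
    refine integral_congr_ae (Eventually.of_forall fun y => ?_)
    simp only [corrFun, mul_one]
    exact (ContinuousLinearMap.integral_apply (integrable_of_norm_le hAt hCA) _).symm
  have hm := stronglyMeasurable_corrFun (Q := Q) hAt 1 k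
  have e4 : ∫ y, ∫ v, corrFun Q At 1 k v (e (y 0)) ∂((Q ^ (i + 1)) (y 0)) ∂ν =
      ∫ y, avg Q (i + 1) (corrFun Q At 1 k) (y 0) (e (y 0)) ∂ν :=
    integral_congr_ae (Eventually.of_forall fun y => (ContinuousLinearMap.integral_apply
      (integrable_of_norm_le hm (norm_corrFun_le hCA 1 k)) _).symm)
  rw [e0, e1, e3, e2, e4]
  unfold corr
  rw [← hν0, integral_map (hev 0).aemeasurable (stronglyMeasurable_apply
    (stronglyMeasurable_avg _ hm) ((1 : Mat d).continuous.comp_stronglyMeasurable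
      he)).aestronglyMeasurable]
  rfl

/-- The vector `(J⁽⁰⁾, J⁽¹⁾, J⁽²⁾)` at time `n` along a path. -/
def jVec (α : ℝ) (Abar : Mat d) (At : Z → Mat d) (e : Z → Vec d) (x : ℕ → Z) (n : ℕ) :
    Vec d × Vec d × Vec d :=
  (J α Abar At e x 0 n, J α Abar At e x 1 n, J α Abar At e x 2 n)

variable {α : ℝ} {Abar : Mat d}

theorem jVec_zero (x : ℕ → Z) : jVec α Abar At e x 0 = 0 := by simp [jVec, J]

theorem jVec_succ (x : ℕ → Z) (n : ℕ) :
    jVec α Abar At e x (n + 1) = stepJ α Abar At e (x (n + 1), jVec α Abar At e x n) := by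
  simp [jVec, stepJ, J]

theorem jVec_congr {x y : ℕ → Z} {n : ℕ} (h : ∀ i ≤ n, x i = y i) :
    jVec α Abar At e x n = jVec α Abar At e y n := by
  induction n with
  | zero => rw [jVec_zero, jVec_zero]
  | succ n ih =>
    rw [jVec_succ, jVec_succ, ih (fun i hi => h i (by omega)), h (n + 1) le_rfl]

theorem measurable_jVec (hst : Measurable (stepJ α Abar At e)) (n : ℕ) :
    Measurable fun x : ℕ → Z => jVec α Abar At e x n := by
  induction n with
  | zero => simp only [jVec_zero]; exact measurable_const
  | succ n ih =>
    simp only [jVec_succ]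
    exact hst.comp ((measurable_pi_apply _).prodMk ih)

/-- `J_{n+1}` is a function of `X_{n+1}` and `J_n`, and `X_{n+2}` is drawn from `Q(X_{n+1}, ·)`
given the path; pairing `X_{n+1}` with `J_n` therefore gives a skew product. It starts at `J_0 = 0`,
inside the ball, for any law of `X_0`. -/
theorem isLawSeq_jVec {hst : Measurable (stepJ α Abar At e)}
    {N : Seminorm ℝ (Vec d × Vec d × Vec d)} {β r : ℝ}
    (hc : IsContractive (stepJ α Abar At e) N β r) (hX : IsMarkovChain Q P X) :
    IsLawSeq Q (stepJ α Abar At e) hst N r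
      (fun n => P.map fun ω => (X (n + 1) ω, jVec α Abar At e (fun m => X m ω) n)) := by
  have hXm : Measurable fun ω n => X n ω := measurable_pi_iff.2 hX.measurable
  have hjX := fun n => (measurable_jVec hst n).comp hXm
  have hm : ∀ n, Measurable fun ω => (X (n + 1) ω, jVec α Abar At e (fun m => X m ω) n) := fun n =>
    (hX.measurable _).prodMk (hjX n)
  refine ⟨fun n => Measure.isProbabilityMeasure_map (hm n).aemeasurable, ?_, fun n => ?_⟩
  · rw [ae_map_iff (hm 0).aemeasurable (measurableSet_ball hc.cont r)]
    refine Eventually.of_forall fun ω => ?_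
    rw [jVec_zero, map_zero]
    exact hc.radius_nonneg
  · refine Measure.ext_of_lintegral _ fun f hf => ?_
    have hj := measurable_jVec hst (n + 1)
    have h := hX.isMarkovLaw (n + 1) (fun p => f (p.2, jVec α Abar At e p.1 (n + 1)))
      (hf.comp (measurable_snd.prodMk (hj.comp measurable_fst)))
    have hcongr : ∀ y : ℕ → Z, jVec α Abar At e (trunc (n + 1) y) (n + 1) =
        jVec α Abar At e y (n + 1) := fun y =>
      jVec_congr fun i hi => by rw [trunc, min_eq_left hi]
    simp only [hcongr] at h
    have hi : Measurable fun p : (ℕ → Z) × Z => f (p.2, jVec α Abar At e p.1 (n + 1)) :=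
      hf.comp (measurable_snd.prodMk (hj.comp measurable_fst))
    have hi' : Measurable fun y : ℕ → Z => f (y (n + 1 + 1), jVec α Abar At e y (n + 1)) :=
      hi.comp (measurable_id.prodMk (measurable_pi_apply _))
    have hK : Measurable fun y : ℕ → Z =>
        ∫⁻ v, f (v, jVec α Abar At e y (n + 1)) ∂(Q (y (n + 1))) :=
      Measurable.lintegral_kernel_prod_right'
        (κ := Q.comap (fun y : ℕ → Z => y (n + 1)) (measurable_pi_apply _)) hi
    rw [lintegral_map hi' hXm, lintegral_map hK hXm] at h
    rw [Measure.lintegral_bind (Kernel.aemeasurable _) hf.aemeasurable,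
      lintegral_map (Measurable.lintegral_kernel hf) (hm n), lintegral_map hf (hm (n + 1))]
    refine h.trans (lintegral_congr fun ω => ?_)
    rw [skewKernel_apply, lintegral_map hf (by fun_prop)]
    simp only [jVec_succ]

end Stationary

/-! ### Centring of `Ã` and `ε` -/

section Means

variable {d : ℕ} {Z : Type*} [MeasurableSpace Z] {π : Measure Z} [IsProbabilityMeasure π]
  {A : Z → Mat d} {b : Z → Vec d} {Abar : Mat d} {bbar θ : Vec d}

theorem norm_centered_le_constA (h : BddAbove (Set.range fun z => ‖centered A Abar z‖)) (z : Z) :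
    ‖centered A Abar z‖ ≤ constA A Abar :=
  (le_ciSup h z).trans (le_max_right _ _)

theorem norm_le_constA (h : BddAbove (Set.range fun z => ‖A z‖)) (z : Z) :
    ‖A z‖ ≤ constA A Abar :=
  (le_ciSup h z).trans (le_max_left _ _)

theorem integral_centered_eq_zero (hA : StronglyMeasurable A)
    (hA_bdd : BddAbove (Set.range fun z => ‖A z‖)) (hA_mean : ∫ z, A z ∂π = Abar) :
    ∫ z, centered A Abar z ∂π = 0 := by
  have hi : Integrable A π := integrable_of_norm_le hA (norm_le_constA (Abar := Abar) hA_bdd)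
  unfold centered
  rw [integral_sub hi (integrable_const _), hA_mean, integral_const, probReal_univ, one_smul,
    sub_self]

/-- Integrability of `b` is recovered from the boundedness of `Ã` and `ε`, because `b = Ã θ - ε +
bbar`. -/
theorem integral_noise_eq_zero (hA : StronglyMeasurable A)
    (hAt_bdd : BddAbove (Set.range fun z => ‖centered A Abar z‖))
    (hA0 : ∫ z, centered A Abar z ∂π = 0) (he : StronglyMeasurable (noise A b Abar bbar θ))
    (he_bdd : BddAbove (Set.range fun z => ‖noise A b Abar bbar θ z‖))
    (hb_mean : ∫ z, b z ∂π = bbar) : ∫ z, noise A b Abar bbar θ z ∂π = 0 := by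
  have hc : Integrable (centered A Abar) π :=
    integrable_of_norm_le (hA.sub stronglyMeasurable_const) (norm_centered_le_constA hAt_bdd)
  have he' : Integrable (noise A b Abar bbar θ) π := integrable_of_norm_le he (le_ciSup he_bdd)
  have hcθ : Integrable (fun z => centered A Abar z θ) π := hc.apply_continuousLinearMap θ
  have h0 : ∫ z, centered A Abar z θ ∂π = 0 := by
    rw [← ContinuousLinearMap.integral_apply hc, hA0]; rfl
  have hb : Integrable b π := by
    have : b = fun z => centered A Abar z θ - noise A b Abar bbar θ z + bbar := by
      funext z; simp [noise]
    rw [this]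
    exact (hcθ.sub he').add (integrable_const _)
  have hbc : Integrable (fun z => b z - bbar) π := hb.sub (integrable_const _)
  unfold noise
  rw [integral_sub hcθ hbc, integral_sub hb (integrable_const _), h0,
    hb_mean, integral_const, probReal_univ, one_smul, sub_self, sub_self]

end Means

/-- In finite dimension injectivity already gives an equivalence, so `inverse` is the true inverse
and not its default value. -/
theorem inverse_apply_apply {d : ℕ} {B : Mat d} (hB : ∀ x, B x = 0 → x = 0) (x : Vec d) :
    B.inverse (B x) = x ∧ B (B.inverse x) = x := by
  have hi : Function.Injective (B : Vec d →ₗ[ℝ] Vec d) :=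
    (injective_iff_map_eq_zero _).2 hB
  let e : Vec d ≃L[ℝ] Vec d := (LinearEquiv.ofInjectiveEndo _ hi).toContinuousLinearEquiv
  have he : B = (e : Vec d →L[ℝ] Vec d) := by ext1 x; rfl
  rw [he, ContinuousLinearMap.inverse_equiv]
  exact ⟨e.symm_apply_apply x, e.apply_symm_apply x⟩

/-! ### Replacing the powers of `1 - α • Abar` by the identity -/

section Bias

variable {d : ℕ} {Z : Type*} [MeasurableSpace Z] {Q : Kernel Z Z} [IsMarkovKernel Q]
  {π : Measure Z} [IsProbabilityMeasure π] {At : Z → Mat d} {e : Z → Vec d} {CA Ce : ℝ}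

theorem summable_norm_corr_one (hπ : Q.Invariant π) (hAt : StronglyMeasurable At)
    (hCA : ∀ z, ‖At z‖ ≤ CA) (hAt0 : ∫ z, At z ∂π = 0) (he : StronglyMeasurable e)
    (hCe : ∀ z, ‖e z‖ ≤ Ce) (he0 : ∫ z, e z ∂π = 0) {t : ℕ} (ht : 1 ≤ t)
    (hs : ∀ n, 1 ≤ n → dobrushin (Q ^ n) ≤ mixRate t n) :
    Summable fun q : ℕ × ℕ => ‖corr Q π At e 1 1 q.1 q.2‖ :=
  (((summable_mixRate_succ_mul ht).mul_left (4 * CA ^ 2 * Ce)).mul_right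
    (‖(1 : Mat d)‖ * ‖(1 : Mat d)‖)).of_nonneg_of_le (fun _ => norm_nonneg _) fun q =>
      norm_corr_le hπ hAt hCA hAt0 he hCe he0 1 1 (hs _ (by omega)) (hs _ (by omega))

/-- The difference of the two series converges absolutely by the weighted mixing sum, and so does
the unperturbed series. Hence the perturbed family is summable over pairs, and both iterated sums
can be compared termwise. -/
theorem norm_tsum_corr_pow_sub_le [NeZero d] (hπ : Q.Invariant π) (hAt : StronglyMeasurable At)
    (hCA : ∀ z, ‖At z‖ ≤ CA) (hAt0 : ∫ z, At z ∂π = 0) (he : StronglyMeasurable e)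
    (hCe : ∀ z, ‖e z‖ ≤ Ce) (he0 : ∫ z, e z ∂π = 0) {t : ℕ} (ht : 1 ≤ t)
    (hs : ∀ n, 1 ≤ n → dobrushin (Q ^ n) ≤ mixRate t n) {a : Mat d} {x : ℝ} (ha : ‖a‖ ≤ x)
    (hxt : x * t ≤ 1 / 8) :
    ‖∑' k, ∑' i, corr Q π At e ((1 + a) ^ k) ((1 + a) ^ i) k i -
      ∑' k, ∑' i, corr Q π At e 1 1 k i‖ ≤
      4 * CA ^ 2 * Ce * ∑' q : ℕ × ℕ,
        mixRate t (q.1 + 1) * mixRate t (q.2 + 1) * ((1 + x) ^ (q.1 + q.2) - 1) := by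
  obtain ⟨hsum, -⟩ := summable_and_tsum_mixRate_le ht ((norm_nonneg a).trans ha) hxt
  have h1 : Summable fun q : ℕ × ℕ => corr Q π At e 1 1 q.1 q.2 :=
    (summable_norm_corr_one hπ hAt hCA hAt0 he hCe he0 ht hs).of_norm
  have hle : ∀ q : ℕ × ℕ, ‖corr Q π At e ((1 + a) ^ q.1) ((1 + a) ^ q.2) q.1 q.2 -
      corr Q π At e 1 1 q.1 q.2‖ ≤ 4 * CA ^ 2 * Ce *
        (mixRate t (q.1 + 1) * mixRate t (q.2 + 1) * ((1 + x) ^ (q.1 + q.2) - 1)) := fun q =>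
    (norm_corr_pow_sub_corr_one_le hπ hAt hCA hAt0 he hCe he0 ha (hs _ (by omega))
      (hs _ (by omega))).trans_eq (by ring)
  have hdiff := Summable.of_norm_bounded (hsum.mul_left (4 * CA ^ 2 * Ce)) hle
  have h2 : Summable fun q : ℕ × ℕ => corr Q π At e ((1 + a) ^ q.1) ((1 + a) ^ q.2) q.1 q.2 :=
    (hdiff.add h1).congr fun q => by abel
  rw [← h1.tsum_prod, ← h2.tsum_prod, ← h2.tsum_sub h1, ← tsum_mul_left]
  exact tsum_of_norm_bounded (hsum.mul_left _).hasSum hle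

end Bias

end LSA

/-! ### Assembly of the proposition -/

open LSA in
theorem mainTheorem9 {d : ℕ} (hd : 1 ≤ d)
    {Z : Type*} [TopologicalSpace Z] [PolishSpace Z] [MeasurableSpace Z] [BorelSpace Z]
    (Q : Kernel Z Z) [IsMarkovKernel Q] (π : Measure Z) [IsProbabilityMeasure π]
    (A : Z → LSA.Mat d) (b : Z → LSA.Vec d) (hA : Measurable A) (hb : Measurable b)
    (Abar S : LSA.Mat d) (bbar θstar : LSA.Vec d)
    -- boundedness of `A`, and `-Abar` is Hurwitz
    (hA_bdd : BddAbove (Set.range fun z => ‖A z‖))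
    (hAt_bdd : BddAbove (Set.range fun z => ‖LSA.centered A Abar z‖))
    (hHurwitz : LSA.IsHurwitz (-Abar))
    -- the target `θ⋆` and the Lyapunov matrix
    (hθ : Abar θstar = bbar) (hS : LSA.IsLyapunovSolution Abar S)
    -- means under `π`, and bounded noise
    (hA_mean : ∫ z, A z ∂π = Abar) (hb_mean : ∫ z, b z ∂π = bbar)
    (hε_bdd : BddAbove (Set.range fun z => ‖LSA.noise A b Abar bbar θstar z‖))
    -- `π` is invariant and `Q` is uniformly geometrically ergodic
    (hπ : Q.Invariant π) (tmix : ℕ) (htmix : 1 ≤ tmix)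
    (hmix : ∀ k : ℕ, 1 ≤ k → LSA.dobrushin (Q ^ k) ≤ (1 / 4 : ℝ) ^ (k / tmix))
    -- the chain `X` started from any initial law, and the stationary chain `Xinf`
    {Ω : Type*} [MeasurableSpace Ω] (P : Measure Ω) [IsProbabilityMeasure P]
    (X : ℕ → Ω → Z) (hX : LSA.IsMarkovChain Q P X)
    {Ω' : Type*} [MeasurableSpace Ω'] (Pinf : Measure Ω') [IsProbabilityMeasure Pinf]
    (Xinf : ℕ → Ω' → Z) (hXinf : LSA.IsMarkovChain Q Pinf Xinf)
    (hXinf_init : Pinf.map (Xinf 0) = π)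
    -- the step size
    (α : ℝ) (hα_pos : 0 < α)
    (hα_lt : α < LSA.alphaB Abar S (LSA.constA A Abar) tmix 1) :
    ∃ PiJ : Measure (Z × LSA.Vec d × LSA.Vec d × LSA.Vec d),
      -- `PiJ` is the unique invariant distribution of `(Z_{t+1}, J_t^{(0)}, J_t^{(1)}, J_t^{(2)})`
      (IsProbabilityMeasure PiJ ∧
        (LSA.kernelJ2 Q α Abar (LSA.measurable_centered hA Abar)
          (LSA.measurable_noise hA hb Abar bbar θstar)).Invariant PiJ ∧
        ∀ PiJ' : Measure (Z × LSA.Vec d × LSA.Vec d × LSA.Vec d), IsProbabilityMeasure PiJ' →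
          (LSA.kernelJ2 Q α Abar (LSA.measurable_centered hA Abar)
            (LSA.measurable_noise hA hb Abar bbar θstar)).Invariant PiJ' → PiJ' = PiJ) ∧
      -- the expectations are well defined, and `lim E[J_n^{(2)}] = E[J_∞^{(2)}]`
      Integrable (fun y => y.2.2.2) PiJ ∧
      (∀ n : ℕ, Integrable (fun ω => LSA.J α Abar (LSA.centered A Abar)
        (LSA.noise A b Abar bbar θstar) (fun m => X m ω) 2 n) P) ∧
      Tendsto (fun n : ℕ => ∫ ω, LSA.J α Abar (LSA.centered A Abar)
          (LSA.noise A b Abar bbar θstar) (fun m => X m ω) 2 n ∂P) atTop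
        (𝓝 (∫ y, y.2.2.2 ∂PiJ)) ∧
      -- the series defining `Δ₂` converges absolutely
      (∀ k i : ℕ, Integrable (fun ω => LSA.centered A Abar (Xinf (k + 1 + i + 1) ω)
        (LSA.centered A Abar (Xinf (i + 1) ω)
          (LSA.noise A b Abar bbar θstar (Xinf 0 ω)))) Pinf) ∧
      Summable (fun q : ℕ × ℕ => ‖LSA.corrTerm Pinf Xinf (LSA.centered A Abar)
        (LSA.noise A b Abar bbar θstar) (q.1 + 1) q.2‖) ∧
      -- `E[J_∞^{(2)}] = α² Δ₂ + R₂` with the bounds on `R₂`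
      ∃ R₂ : LSA.Vec d,
        ∫ y, y.2.2.2 ∂PiJ = α ^ 2 • LSA.Delta2 Pinf Xinf Abar (LSA.centered A Abar)
          (LSA.noise A b Abar bbar θstar) + R₂ ∧
        ‖Abar R₂‖ ≤ LSA.constDb S (LSA.constA A Abar) tmix * (tmix : ℝ) ^ 4 * α ^ (5 / 2 : ℝ) *
          LSA.supNorm (LSA.noise A b Abar bbar θstar) ∧
        ‖R₂‖ ≤ ‖Abar.inverse‖ * (LSA.constDb S (LSA.constA A Abar) tmix * (tmix : ℝ) ^ 4 *
          α ^ (5 / 2 : ℝ) * LSA.supNorm (LSA.noise A b Abar bbar θstar)) := by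
  have : NeZero d := ⟨by omega⟩
  have hCA : ∀ z, ‖centered A Abar z‖ ≤ constA A Abar := norm_centered_le_constA hAt_bdd
  have hCe : ∀ z, ‖noise A b Abar bbar θstar z‖ ≤ supNorm (noise A b Abar bbar θstar) :=
    le_ciSup hε_bdd
  have hAm : StronglyMeasurable A := hA.stronglyMeasurable
  have hAtm := measurable_centered hA Abar
  have hem := measurable_noise hA hb Abar bbar θstar
  have hAts := hAtm.stronglyMeasurable
  have hes := hem.stronglyMeasurable
  have hAt0 := integral_centered_eq_zero hAm hA_bdd hA_mean
  have he0 := integral_noise_eq_zero hAm hAt_bdd hAt0 hes hε_bdd hb_mean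
  have hAbar : ‖Abar‖ ≤ constA A Abar := by
    conv_lhs => rw [← hA_mean]
    exact norm_integral_le_of_norm_le_prob (Eventually.of_forall (norm_le_constA hA_bdd))
  have hst := measurable_stepJ α Abar hAtm hem
  have ha := hS.rateA_pos hd
  have hCA0 : 0 < constA A Abar := (ha.trans_le (hS.rateA_le hd)).trans_le hAbar
  have hCe0 : 0 ≤ supNorm (noise A b Abar bbar θstar) := Real.iSup_nonneg fun _ => norm_nonneg _
  set At := centered A Abar with hAt_def
  set e := noise A b Abar bbar θstar with he_def
  set CA := constA A Abar with hCA_def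
  set Ce := supNorm e with hCe_def
  obtain ⟨hαt, hα1, hαC⟩ := hS.stepSize_bounds hd hα_pos hAbar htmix hα_lt
  have hs : ∀ n, 1 ≤ n → dobrushin (Q ^ n) ≤ mixRate tmix n := hmix
  have hs0 := tendsto_mixRate htmix
  have hβ1 : √(1 - α * rateA S) < 1 := by
    rw [Real.sqrt_lt' one_pos]; nlinarith [mul_pos hα_pos ha]
  have hpc : ∀ x, ‖x‖ ≤ √(2 / α) * hS.wSeminorm x := hS.norm_le_wNorm hd hα_pos hAbar hαC
  have hpM : ∀ x, hS.wSeminorm x ≤ √‖S‖ * ‖x‖ := wNorm_le S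
  have hB : ∀ x, hS.wSeminorm ((1 - α • Abar) x) ≤ √(1 - α * rateA S) * hS.wSeminorm x :=
    hS.wNorm_step_le hd hα_pos hAbar hαC
  have hpow := exists_norm_pow_le (Real.sqrt_nonneg _) (Real.sqrt_nonneg _) hpc hpM
    (Real.sqrt_nonneg _) hB
  obtain ⟨N, β, r, hc⟩ := exists_isContractive_stepJ hα_pos.le hCA0.le hCe0 (Real.sqrt_nonneg _)
    (Real.sqrt_nonneg _) hpc hpM (Real.sqrt_nonneg _) hβ1 hB hCA hCe
  -- A vector in the kernel of `Abar` is fixed by the strict contraction `1 - α • Abar`, hence zero.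
  have hinj : ∀ x, Abar x = 0 → x = 0 := fun x hx => by
    have h1 := hB x
    have h2 : (1 - α • Abar) x = x := by simp [hx]
    rw [h2] at h1
    have h3 : hS.wSeminorm x ≤ 0 := by nlinarith [apply_nonneg hS.wSeminorm x]
    refine norm_le_zero_iff.1 ((hpc x).trans ?_)
    exact mul_nonpos_of_nonneg_of_nonpos (Real.sqrt_nonneg _) h3
  obtain ⟨PiJ, hPp, hPi⟩ := exists_invariant (hst := hst) hc hπ
  have hball := ae_ball_of_invariant hc hPi
  obtain ⟨c2, -, ht2⟩ := isTest_proj hc (proj2 d)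
  -- The test function is `j₂` itself, which yields integrability and the convergence of the means
  -- together.
  have ht := ht2 (fun _ => 1) _ stronglyMeasurable_const (norm_nonneg _) (fun _ => le_rfl)
  have hlaw := isLawSeq_jVec (hst := hst) hc hX
  have hm : ∀ n, Measurable fun ω => (X (n + 1) ω, jVec α Abar At e (fun m => X m ω) n) := fun n =>
    (hX.measurable _).prodMk ((measurable_jVec hst n).comp (measurable_pi_iff.2 hX.measurable))
  have hcorr := corrTerm_eq_corr hXinf hXinf_init hAts hCA hes hCe
  refine ⟨PiJ, ⟨hPp, hPi, fun PiJ' hP' hPi' => eq_of_invariant hc hπ hs hs0 hPi hPi'⟩,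
    ht.integrable hball, fun n => ?_, ?_, fun k i => ?_, ?_, ?_⟩
  · have := hlaw.prob n
    exact (ht.integrable (hlaw.ae_ball hc n)).comp_measurable (hm n)
  · refine (hlaw.tendsto_integral hc hπ hs hs0 hPi hball ht).congr fun n => ?_
    exact integral_map (hm n).aemeasurable ht.meas.aestronglyMeasurable
  · have hAX := fun j => hAts.comp_measurable (hXinf.measurable j)
    exact integrable_of_norm_le (stronglyMeasurable_apply (hAX _) (stronglyMeasurable_apply (hAX _)
      (hes.comp_measurable (hXinf.measurable 0)))) fun ω =>
        norm_apply_le_mul (hCA _) (norm_apply_le_mul (hCA _) (hCe _))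
  · exact (summable_norm_corr_one hπ hAts hCA hAt0 hes hCe he0 htmix hs).congr fun q =>
      congrArg norm (hcorr q.1 q.2).symm
  · set m := ∫ y, y.2.2.2 ∂PiJ with hm_def
    set D := Delta2 Pinf Xinf Abar At e with hD_def
    have hAm := apply_integral_proj2 hc hPi hα_pos.ne' hAts hCA
    rw [integral_proj1_eq_tsum_corr hc hPi hπ hs hs0 hAts hCA hes hCe (Real.sqrt_nonneg _) hβ1 hpow]
      at hAm
    have hAD : Abar D = -∑' k, ∑' i, corr Q π At e 1 1 k i := by
      rw [hD_def, Delta2, map_neg, (inverse_apply_apply hinj _).2]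
      simp only [hcorr]
    have hx : ‖-(α • Abar)‖ ≤ α * CA := by
      rw [norm_neg, norm_smul, Real.norm_of_nonneg hα_pos.le]
      exact mul_le_mul_of_nonneg_left hAbar hα_pos.le
    have hbias := norm_tsum_corr_pow_sub_le hπ hAts hCA hAt0 hes hCe he0 htmix hs hx hαt
    rw [← sub_eq_add_neg] at hbias
    -- `Abar m` and `α² Abar D` are `-α²` times the correlation series with and without the powers
    -- of `1 - α • Abar`, so only the difference of the two series has to be bounded.
    have hAR : ‖Abar (m - α ^ 2 • D)‖ ≤ constDb S CA tmix * (tmix : ℝ) ^ 4 * α ^ (5 / 2 : ℝ) * Ce := by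
      have h1 : Abar (m - α ^ 2 • D) = -(α ^ 2 • (∑' k, ∑' i, corr Q π At e ((1 - α • Abar) ^ k)
          ((1 - α • Abar) ^ i) k i - ∑' k, ∑' i, corr Q π At e 1 1 k i)) := by
        rw [map_sub, map_smul, hAD, hAm, smul_sub, smul_neg]
        abel
      rw [h1, norm_neg, norm_smul, Real.norm_of_nonneg (by positivity)]
      have hD1 : 0 ≤ 12 * constD1 S CA * CA * √(rateA S) := by unfold constD1; positivity
      exact (mul_le_mul_of_nonneg_left hbias (by positivity)).trans (rpow_five_halves_bound hα_pos
        hα1 hCe0 hCA0.le (by exact_mod_cast htmix) hD1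
        (summable_and_tsum_mixRate_le htmix (by positivity) hαt).2)
    refine ⟨m - α ^ 2 • D, (add_sub_cancel _ _).symm, hAR, ?_⟩
    calc ‖m - α ^ 2 • D‖ = ‖Abar.inverse (Abar (m - α ^ 2 • D))‖ := by
          rw [(inverse_apply_apply hinj _).1]
      _ ≤ _ := (Abar.inverse.le_opNorm _).trans
          (mul_le_mul_of_nonneg_left hAR (norm_nonneg _))
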